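/- Let $(M,g)$ be a compact $6$-dimensional smooth Riemannian manifold without boundary. Given constants $\alpha,\beta\in\mathbb R$, functions $R$ and $T_{string}$ on $M$, and differential $p$-forms $F_p$ ($0\le p\le 6$), with pointwise norms $|F_p|$ taken with respect to $g$, consider for positive functions $v,u$ on $M$ the system \begin{gather*} 10uv\,\Delta v+6\,\mathrm{div}(v^{2}\nabla u)-2uv^{2}R+u\sum_{p=0}^{6}v^{3-p}|F_p|^2-2uv^{(q-3)/2}T_{string}=2\alpha v^3,\\ 5\Delta(u^{2}v)+5u^{2}\Delta v-2u^{2}vR-6v|\nabla u|^{2}+\frac{u^2}{2}\sum_{p=0}^{6}(3-p)v^{2-p}|F_p|^2-\frac{q-3}{2}u^{2}v^{(q-5)/2}T_{string}=6\left[\alpha uv^2+\beta v^2\right]. \end{gather*} Let $q=3$ and $F_0=F_2=F_4=F_6\equiv0$; the remaining data then enter the system only through $\alpha$, $\beta$, $F_5$ and the two functions $2R-|F_1|^2$ and $|F_3|^2-2T_{string}$. Let $s>5$ be a real number. Then there is a neighbourhood $\mathcal N$ of $(1,1)$ in $H^s(M)\times H^s(M)$, and there are maps $$(\alpha,\beta,F_5,v,u)\mapsto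 a\in H^{s-2}(M),\qquad (\alpha,\beta,F_5,v,u)\mapsto b\in H^{s-2}(M),$$ defined and continuous for $\alpha,\beta\in\mathbb R$, $F_5$ in the space of $5$-forms of class $H^s$, and $(v,u)\in\mathcal N$ (with the $H^s$ topologies on $F_5,v,u$ and the $H^{s-2}$ topology on $a,b$), such that for all such $(\alpha,\beta,F_5,v,u)$ the functions $v,u$ are positive and of class $C^2$ and the system is satisfied pointwise on $M$ when $2R-|F_1|^2$ is replaced by $a$ and $|F_3|^2-2T_{string}$ by $b$. -/

import Mathlib

open Set MeasureTheory Topology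
open scoped Manifold ContDiff FourierTransform ENNReal

noncomputable section

/-- The model space `ℝ⁶`. -/
abbrev E6 : Type := EuclideanSpace ℝ (Fin 6)

/-- The standard basis of `ℝ⁶`. -/
def stdVec (i : Fin 6) : E6 := EuclideanSpace.single i (1 : ℝ)

/-! ### Sobolev spaces of real order -/

/-- `ξ ↦ (1 + |ξ|²)^{s/2} f̂(ξ)`. -/
def besselFourier (s : ℝ) (f : E6 → ℝ) (ξ : E6) : ℂ :=
  (((1 + ‖ξ‖ ^ 2) ^ (s / 2) : ℝ) : ℂ) * 𝓕 (fun y : E6 => (f y : ℂ)) ξ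

/-- Membership in `H^s(ℝ⁶)` of an integrable function `f` (it is used only for continuous functions
with compact support): `(1 + |ξ|²)^{s/2} f̂(ξ)` is square integrable. The `H^s` norm of `f` is the
`L²` norm of that function. -/
def MemHsEuclidean (s : ℝ) (f : E6 → ℝ) : Prop :=
  MemLp (besselFourier s f) 2 volume

section Manifold

variable (M : Type*) [TopologicalSpace M] [ChartedSpace E6 M]

/-- A localizer on `M`: a smooth chart `e` of `M` (any element of the maximal smooth atlas) together
with a smooth cut-off function `χ` with compact support in the image of `e`. -/
structure Localizer where
  chart : OpenPartialHomeomorph M E6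
  chart_mem : chart ∈ IsManifold.maximalAtlas (𝓡 6) ∞ M
  cutoff : E6 → ℝ
  smooth : ContDiff ℝ ∞ cutoff
  compact : HasCompactSupport cutoff
  support : tsupport cutoff ⊆ chart.target

variable {M}

/-- The localization `χ · (f ∘ e⁻¹)` of a function on `M`, extended by zero to `ℝ⁶`. -/
def Localizer.loc (l : Localizer M) (f : M → ℝ) (y : E6) : ℝ :=
  l.cutoff y * f (l.chart.symm y)

variable (M)

/-- The space `H^s(M)` of a compact 6-manifold: functions all of whose localizations are in
`H^s(ℝ⁶)`. Only `s > 3` is used. Then, by the Sobolev embedding, every element of `H^s(M)` has exactly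
one continuous representative, and it is this representative that is recorded. -/
structure HsFunction (s : ℝ) where
  toFun : M → ℝ
  continuous_toFun : Continuous toFun
  memHs : ∀ l : Localizer M, MemHsEuclidean s (l.loc toFun)

variable {M}

instance (s : ℝ) : CoeFun (HsFunction M s) (fun _ => M → ℝ) := ⟨HsFunction.toFun⟩

/-- The `H^s` topology: the coarsest one for which all localizations `f ↦ χ · (f ∘ e⁻¹)` are
continuous into `H^s(ℝ⁶)` with its norm. -/
instance (s : ℝ) : TopologicalSpace (HsFunction M s) :=
  ⨅ l : Localizer M, TopologicalSpace.induced
    (fun f : HsFunction M s => (f.memHs l).toLp (besselFourier s (l.loc f))) inferInstance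

/-- A smooth function with compact support is in every `H^s(ℝ⁶)`. -/
theorem memHsEuclidean_of_smooth (s : ℝ) {f : E6 → ℝ} (hf : ContDiff ℝ ∞ f)
    (hc : HasCompactSupport f) : MemHsEuclidean s f := by
  have h1 : HasCompactSupport (fun y : E6 => (f y : ℂ)) :=
    hc.comp_left (g := Complex.ofReal) Complex.ofReal_zero
  have h2 : ContDiff ℝ ∞ (fun y : E6 => (f y : ℂ)) := Complex.ofRealCLM.contDiff.comp hf
  set φ : SchwartzMap E6 ℂ := h1.toSchwartzMap h2 with hφ
  have h3 : Function.HasTemperateGrowth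
      (fun ξ : E6 => (((1 + ‖ξ‖ ^ 2) ^ (s / 2) : ℝ) : ℂ)) := by fun_prop
  have h4 := (SchwartzMap.smulLeftCLM ℂ (fun ξ : E6 => (((1 + ‖ξ‖ ^ 2) ^ (s / 2) : ℝ) : ℂ))
    (𝓕 φ)).memLp 2 (volume : Measure E6)
  have h5 : (SchwartzMap.smulLeftCLM ℂ (fun ξ : E6 => (((1 + ‖ξ‖ ^ 2) ^ (s / 2) : ℝ) : ℂ))
    (𝓕 φ) : E6 → ℂ) = besselFourier s f := by
    ext ξ
    rw [SchwartzMap.smulLeftCLM_apply_apply h3]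
    rfl
  rw [h5] at h4
  exact h4

/-- The constant function `1`, as an element of `H^s(M)`. -/
instance (s : ℝ) : One (HsFunction M s) where
  one :=
    { toFun := fun _ => 1
      continuous_toFun := continuous_const
      memHs := fun l => by
        have : l.loc (fun _ : M => (1 : ℝ)) = l.cutoff := by
          ext y; simp [Localizer.loc]
        rw [this]
        exact memHsEuclidean_of_smooth s l.smooth l.compact }

/-! ### Differential forms of class `H^s` -/

variable (M)

/-- Differential `p`-forms on `M` (no regularity). -/
abbrev DiffForm (p : ℕ) : Type _ :=
  (x : M) → TangentSpace (𝓡 6) x [⋀^Fin p]→L[ℝ] ℝ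

variable {M}

/-- The vector `∂_w` at `e⁻¹(y)`: the image under `d(e⁻¹)` of the vector `w ∈ ℝ⁶`. -/
def chartVec (e : OpenPartialHomeomorph M E6) (y w : E6) : TangentSpace (𝓡 6) (e.symm y) :=
  mfderiv (𝓡 6) (𝓡 6) e.symm y w

/-- The component `F(∂_{w₁}, …, ∂_{w_p})` in the chart `e`, as a function on `e.target`. -/
def DiffForm.comp {p : ℕ} (F : DiffForm M p) (e : OpenPartialHomeomorph M E6)
    (w : Fin p → E6) (y : E6) : ℝ :=
  F (e.symm y) (fun k => chartVec e y (w k))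

/-- The localized component `χ · F(∂_{w₁}, …, ∂_{w_p})`. -/
def Localizer.locForm {p : ℕ} (l : Localizer M) (w : Fin p → E6) (F : DiffForm M p) (y : E6) : ℝ :=
  l.cutoff y * F.comp l.chart w y

variable (M)

/-- The space of `p`-forms of class `H^s` (used for `s > 3`, through continuous representatives):
the components in all charts, cut off, are in `H^s(ℝ⁶)`. -/
structure HsForm (p : ℕ) (s : ℝ) where
  toForm : DiffForm M p
  continuousOn_comp : ∀ e ∈ IsManifold.maximalAtlas (𝓡 6) ∞ M, ∀ w : Fin p → E6,
    ContinuousOn (toForm.comp e w) e.target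
  memHs : ∀ (l : Localizer M) (w : Fin p → E6), MemHsEuclidean s (l.locForm w toForm)

variable {M}

/-- The `H^s` topology on `p`-forms. -/
instance (p : ℕ) (s : ℝ) : TopologicalSpace (HsForm M p s) :=
  ⨅ (l : Localizer M) (w : Fin p → E6), TopologicalSpace.induced
    (fun F : HsForm M p s => (F.memHs l w).toLp (besselFourier s (l.locForm w F.toForm)))
    inferInstance

/-! ### Riemannian geometry -/

variable [IsManifold (𝓡 6) ∞ M]

variable (M) in
/-- Smooth Riemannian metrics on `M`. -/
abbrev SmoothMetric : Type _ :=
  Bundle.ContMDiffRiemannianMetric (𝓡 6) ∞ E6 (fun x : M => TangentSpace (𝓡 6) x)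

/-- The Gram matrix of `g` in the standard basis of `T_xM` (which is by definition a copy of
`ℝ⁶`). The two definitions below that use it do not depend on the basis. -/
def gramAt (g : SmoothMetric M) (x : M) : Matrix (Fin 6) (Fin 6) ℝ :=
  Matrix.of fun i j => g.inner x (stdVec i : TangentSpace (𝓡 6) x) (stdVec j : TangentSpace (𝓡 6) x)

/-- The differential of a real function at `x`, as a linear form on `T_xM`. -/
def dReal (f : M → ℝ) (x : M) : TangentSpace (𝓡 6) x →L[ℝ] ℝ :=
  mfderiv (𝓡 6) 𝓘(ℝ, ℝ) f x

/-- The gradient `∇f = g^{ij} (∂_j f) ∂_i`. -/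
def grad (g : SmoothMetric M) (f : M → ℝ) (x : M) : TangentSpace (𝓡 6) x :=
  ∑ i, ∑ j, ((gramAt g x)⁻¹ i j * dReal f x (stdVec j)) •
    (stdVec i : TangentSpace (𝓡 6) x)

/-- The pointwise norm squared of a `p`-form,
`|F|² = (1/p!) g^{i₁j₁} ⋯ g^{i_pj_p} F_{i₁…i_p} F_{j₁…j_p}`. -/
def formNormSq {p : ℕ} (g : SmoothMetric M) (F : DiffForm M p) (x : M) : ℝ :=
  (1 / (p.factorial : ℝ)) * ∑ i : Fin p → Fin 6, ∑ j : Fin p → Fin 6,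
    (∏ k, (gramAt g x)⁻¹ (i k) (j k)) * F x (fun k => stdVec (i k)) * F x (fun k => stdVec (j k))

/-- The matrix `g_{ij} = g(∂_i, ∂_j)` of the metric in the chart `e`. -/
def chartGram (g : SmoothMetric M) (e : OpenPartialHomeomorph M E6) (y : E6) :
    Matrix (Fin 6) (Fin 6) ℝ :=
  Matrix.of fun i j => g.inner (e.symm y) (chartVec e y (stdVec i)) (chartVec e y (stdVec j))

/-- The component `X^i` of a vector field in the chart `e`. -/
def chartCoord (e : OpenPartialHomeomorph M E6) (X : (x : M) → TangentSpace (𝓡 6) x)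
    (i : Fin 6) (y : E6) : ℝ :=
  (show E6 from mfderiv (𝓡 6) (𝓡 6) e (e.symm y) (X (e.symm y))) i

/-- The divergence in the chart `e`: `∂_i X^i + Γ^i_{ik} X^k` with
`Γ^i_{ik} = ½ g^{ij} ∂_k g_{ij} = ∂_k log √(det g)`, that is,
`(det g)^{-1/2} ∂_i ((det g)^{1/2} X^i)`. -/
def chartDiv (g : SmoothMetric M) (e : OpenPartialHomeomorph M E6)
    (X : (x : M) → TangentSpace (𝓡 6) x) (y : E6) : ℝ :=
  (∑ i, fderiv ℝ (chartCoord e X i) y (stdVec i)) +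
    ∑ k, (1 / 2 * ∑ i, ∑ j, (chartGram g e y)⁻¹ i j *
      fderiv ℝ (fun z => chartGram g e z i j) y (stdVec k)) * chartCoord e X k y

/-- The divergence of a vector field at `x`, computed in the preferred chart at `x` (for
differentiable fields the value does not depend on the chart). -/
def diverg (g : SmoothMetric M) (X : (x : M) → TangentSpace (𝓡 6) x) (x : M) : ℝ :=
  chartDiv g (chartAt E6 x) X (chartAt E6 x x)

/-- The Laplace–Beltrami operator `Δf = div ∇f`. -/
def lap (g : SmoothMetric M) (f : M → ℝ) (x : M) : ℝ :=
  diverg g (grad g f) x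

/-! ### The equations of motion -/

/-- `(v, u)` is a (classical, positive) solution of the equations of motion with parameters
`L, q`, Lagrange multipliers `α, β`, scalar curvature term `R`, fluxes `F_0, …, F_L` and string
term `T`. -/
structure SolvesEqMotion (g : SmoothMetric M) (L : ℕ) (q : ℤ) (α β : ℝ) (R : M → ℝ)
    (F : (p : ℕ) → DiffForm M p) (T : M → ℝ) (v u : M → ℝ) : Prop where
  contMDiff_v : ContMDiff (𝓡 6) 𝓘(ℝ, ℝ) 2 v
  contMDiff_u : ContMDiff (𝓡 6) 𝓘(ℝ, ℝ) 2 u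
  v_pos : ∀ x, 0 < v x
  u_pos : ∀ x, 0 < u x
  eq_u : ∀ x,
    10 * u x * v x * lap g v x + 6 * diverg g (fun z => v z ^ 2 • grad g u z) x
      - 2 * u x * v x ^ 2 * R x
      + u x * ∑ p ∈ Finset.range (L + 1), v x ^ (3 - (p : ℤ)) * formNormSq g (F p) x
      - 2 * u x * v x ^ (((q : ℝ) - 3) / 2) * T x
    = 2 * α * v x ^ 3
  eq_v : ∀ x,
    5 * lap g (fun z => u z ^ 2 * v z) x + 5 * u x ^ 2 * lap g v x
      - 2 * u x ^ 2 * v x * R x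
      - 6 * v x * g.inner x (grad g u x) (grad g u x)
      + u x ^ 2 / 2 * ∑ p ∈ Finset.range (L + 1),
          (3 - (p : ℝ)) * v x ^ (2 - (p : ℤ)) * formNormSq g (F p) x
      - ((q : ℝ) - 3) / 2 * u x ^ 2 * v x ^ (((q : ℝ) - 5) / 2) * T x
    = 6 * (α * u x * v x ^ 2 + β * v x ^ 2)

end Manifold

end

/-! No differential equation has to be solved: the system is linear and triangular in the two
unknown data. For `q = 3` the string term disappears from the second equation, and so does the `F₃`
term, whose factor is `3 - p = 0`. The second equation is then `-u²v·a` plus known terms, with `a =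
2R - |F₁|²`. The first one contains `-uv²·a + u·b`, with `b = |F₃|² - 2T`. Division by `u²v` and
then by `u` gives `scalarData` and `stringData`; `solvesEqMotion_of_data` checks that these values
are the right ones.

What remains is regularity. Both values are rational expressions in `v`, `u`, their derivatives up
to order two, the components of `F₅` and smooth coefficients of the metric. In dimension 6 the
critical exponent is `6/2 = 3`, so `s > 5` says two things: `H^s` embeds in `C²`, and `H^{s-2}` is
an algebra of continuous functions. Everything rests on four facts about `H^σ(ℝ⁶)` with `σ > 3`.
Products are continuous (`exists_synth_mul`). A derivative costs one order (`exists_synth_deriv`).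
There is a Sobolev embedding (`contDiff_synth`). Reciprocals of positive functions stay in the class
and depend continuously on the function (`LocHs.inv`).

For reciprocals, `H^σ` is completed by a unit to a commutative Banach algebra `HsAlg`. Gelfand
theory applies there: a character vanishing at a noninvertible element of the relevant kind would be
evaluation at a point where that element is nonzero (`HsAlg.isUnit_of_ne_zero`). Continuity of the
reciprocal is continuity of inversion in a Banach algebra.

These facts pass to parametrized families cut off in charts (`LocHs`) and then to families on `M`
(`HsFamily`). The divergence is defined through a chart that varies with the point, so its
invariance under changes of chart (`chartDiv_congr_chart`) is needed to write it as one differential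
operator with smooth coefficients on a whole chart. The neighbourhood consists of all pairs of
positive functions; it is a neighbourhood of `(1, 1)` by the Sobolev embedding and the compactness
of `M`. -/

noncomputable section

/-! ### The Bessel weight -/

/-- The weight `(1 + |ξ|²)^{σ/2}`. -/
def besselWeight (σ : ℝ) (ξ : E6) : ℝ := (1 + ‖ξ‖ ^ 2) ^ (σ / 2)

lemma one_le_one_add_normSq (ξ : E6) : 1 ≤ 1 + ‖ξ‖ ^ 2 := by
  have := sq_nonneg ‖ξ‖
  linarith

lemma besselWeight_pos (σ : ℝ) (ξ : E6) : 0 < besselWeight σ ξ :=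
  Real.rpow_pos_of_pos (by have := one_le_one_add_normSq ξ; linarith) _

lemma continuous_besselWeight (σ : ℝ) : Continuous (besselWeight σ) := by
  unfold besselWeight
  refine Continuous.rpow_const (by fun_prop) fun ξ => Or.inl ?_
  have := one_le_one_add_normSq ξ
  linarith

lemma besselWeight_mul (σ τ : ℝ) (ξ : E6) :
    besselWeight σ ξ * besselWeight τ ξ = besselWeight (σ + τ) ξ := by
  unfold besselWeight
  rw [← Real.rpow_add (by have := one_le_one_add_normSq ξ; linarith)]
  ring_nf

lemma besselWeight_zero (ξ : E6) : besselWeight 0 ξ = 1 := by simp [besselWeight]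

lemma besselWeight_mono {σ τ : ℝ} (h : σ ≤ τ) (ξ : E6) :
    besselWeight σ ξ ≤ besselWeight τ ξ :=
  Real.rpow_le_rpow_of_exponent_le (one_le_one_add_normSq ξ) (by linarith)

lemma norm_le_besselWeight_one (ξ : E6) : ‖ξ‖ ≤ besselWeight 1 ξ := by
  unfold besselWeight
  rw [← Real.sqrt_eq_rpow]
  exact Real.le_sqrt_of_sq_le (by linarith)

lemma norm_pow_le_besselWeight (n : ℕ) (ξ : E6) : ‖ξ‖ ^ n ≤ besselWeight n ξ := by
  induction n with
  | zero => simp [besselWeight_zero]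
  | succ n ih =>
    rw [pow_succ, Nat.cast_succ, ← besselWeight_mul]
    exact mul_le_mul ih (norm_le_besselWeight_one ξ) (norm_nonneg _) (besselWeight_pos _ _).le

/-- The longer of the two vectors dominates: the sum has at most twice its length, whence the factor
4 under the power. This inequality distributes the `σ` derivatives of a product over the two
factors. -/
lemma besselWeight_add_le {σ : ℝ} (hσ : 0 ≤ σ) (ξ η : E6) :
    besselWeight σ (ξ + η) ≤ 4 ^ (σ / 2) * (besselWeight σ ξ + besselWeight σ η) := by
  wlog h : ‖η‖ ≤ ‖ξ‖ generalizing ξ η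
  · have := this η ξ (le_of_not_ge h)
    rwa [add_comm η ξ, add_comm (besselWeight σ η)] at this
  have h1 : 1 + ‖ξ + η‖ ^ 2 ≤ 4 * (1 + ‖ξ‖ ^ 2) := by
    have h2 := norm_add_le ξ η
    have h3 := norm_nonneg (ξ + η)
    have h4 : ‖ξ + η‖ ≤ 2 * ‖ξ‖ := by linarith
    nlinarith [norm_nonneg ξ]
  have h5 : besselWeight σ (ξ + η) ≤ 4 ^ (σ / 2) * besselWeight σ ξ := by
    unfold besselWeight
    rw [← Real.mul_rpow (by norm_num) (by positivity)]
    exact Real.rpow_le_rpow (by positivity) h1 (by linarith)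
  refine h5.trans (mul_le_mul_of_nonneg_left ?_ (by positivity))
  linarith [besselWeight_pos σ η]

/-- The square of the weight is integrable because `2σ` exceeds the dimension 6. By Cauchy–Schwarz,
Fourier transforms of `H^σ` functions are then in `L¹`. -/
lemma memLp_besselWeight_neg {σ : ℝ} (hσ : 3 < σ) :
    MemLp (fun ξ : E6 => (besselWeight (-σ) ξ : ℂ)) 2 volume := by
  have hc : Continuous (fun ξ : E6 => (besselWeight (-σ) ξ : ℂ)) :=
    Complex.continuous_ofReal.comp (continuous_besselWeight _)
  rw [memLp_two_iff_integrable_sq_norm hc.aestronglyMeasurable]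
  have h := integrable_rpow_neg_one_add_norm_sq (E := E6) (μ := volume) (r := 2 * σ)
    (by simp; linarith)
  refine h.congr (Filter.Eventually.of_forall fun ξ => ?_)
  simp only [Complex.norm_real, Real.norm_eq_abs, sq_abs]
  rw [sq (besselWeight (-σ) ξ), besselWeight_mul]
  unfold besselWeight
  ring_nf

lemma integrable_besselWeight_mul {σ : ℝ} (hσ : 3 < σ) {g : E6 → ℂ} (hg : MemLp g 2 volume) :
    Integrable (fun ξ => (besselWeight (-σ) ξ : ℂ) * g ξ) :=
  MemLp.integrable_mul (memLp_besselWeight_neg hσ) hg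

/-! ### Synthesis of `H^σ` functions -/

/-- Multiplication of `L²` functions by `(1 + |ξ|²)^{-σ/2}`, with values in `L¹`. -/
def besselToL1 {σ : ℝ} (hσ : 3 < σ) : Lp ℂ 2 (volume : Measure E6) →L[ℂ] Lp ℂ 1 (volume : Measure E6) :=
  (ContinuousLinearMap.mul ℂ ℂ).holderL volume 2 2 1 ((memLp_besselWeight_neg hσ).toLp _)

lemma coeFn_besselToL1 {σ : ℝ} (hσ : 3 < σ) (g : Lp ℂ 2 (volume : Measure E6)) :
    besselToL1 hσ g =ᵐ[volume] fun ξ => (besselWeight (-σ) ξ : ℂ) * g ξ := by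
  have h := ContinuousLinearMap.coeFn_holder (r := 1) (ContinuousLinearMap.mul ℂ ℂ)
    ((memLp_besselWeight_neg hσ).toLp _) g
  filter_upwards [h, (memLp_besselWeight_neg hσ).coeFn_toLp] with ξ h1 h2
  rw [show besselToL1 hσ g = ContinuousLinearMap.holder 1 (ContinuousLinearMap.mul ℂ ℂ)
    ((memLp_besselWeight_neg hσ).toLp _) g from rfl, h1, h2]
  simp

/-- The continuous function whose Fourier transform is `(1 + |ξ|²)^{-σ/2} g(ξ)`. -/
def synth {σ : ℝ} (hσ : 3 < σ) :
    Lp ℂ 2 (volume : Measure E6) →L[ℂ] BoundedContinuousFunction E6 ℂ :=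
  (Real.Lp.fourierTransformInvCLM E6 ℂ).comp (besselToL1 hσ)

lemma synth_eq {σ : ℝ} (hσ : 3 < σ) (g : Lp ℂ 2 (volume : Measure E6)) :
    (synth hσ g : E6 → ℂ) = 𝓕⁻ (fun ξ => (besselWeight (-σ) ξ : ℂ) * g ξ) := by
  ext x
  simp only [synth, ContinuousLinearMap.comp_apply, Real.Lp.fourierTransformInvCLM_apply,
    Real.Lp.fourierTransformInv_apply]
  exact Real.fourierInv_congr_ae (coeFn_besselToL1 hσ g) x

lemma synth_toLp {σ : ℝ} (hσ : 3 < σ) {g : E6 → ℂ} (hg : MemLp g 2 volume) :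
    (synth hσ (hg.toLp g) : E6 → ℂ) = 𝓕⁻ (fun ξ => (besselWeight (-σ) ξ : ℂ) * g ξ) := by
  rw [synth_eq]
  ext x
  refine Real.fourierInv_congr_ae ?_ x
  filter_upwards [hg.coeFn_toLp] with ξ h
  rw [h]

/-- The Fourier transform is self-adjoint. -/
lemma integral_fourier_mul_eq {f g : E6 → ℂ} (hf : Integrable f) (hg : Integrable g) :
    ∫ ξ, 𝓕 f ξ * g ξ = ∫ x, f x * 𝓕 g x := by
  have h := VectorFourier.integral_fourierIntegral_smul_eq_flip (L := innerₗ E6)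
    (μ := (volume : Measure E6)) (ν := (volume : Measure E6)) Real.continuous_fourierChar
    continuous_inner hf hg
  rw [flip_innerₗ] at h
  exact h

/-- Inversion without continuity: if `h` and `𝓕⁻ h` are integrable then `𝓕 (𝓕⁻ h) = h` almost
everywhere. -/
lemma fourier_fourierInv_ae_eq {h : E6 → ℂ} (hh : Integrable h) (hf : Integrable (𝓕⁻ h)) :
    𝓕 (𝓕⁻ h) =ᵐ[volume] h := by
  have hcont : Continuous (𝓕 (𝓕⁻ h)) :=
    VectorFourier.fourierIntegral_continuous Real.continuous_fourierChar continuous_inner hf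
  refine ae_eq_of_integral_contDiff_smul_eq hcont.locallyIntegrable hh.locallyIntegrable
    fun φ hφ hc => ?_
  have hc' : HasCompactSupport (fun y : E6 => (φ y : ℂ)) :=
    hc.comp_left (g := Complex.ofReal) Complex.ofReal_zero
  have hφ' : ContDiff ℝ ∞ (fun y : E6 => (φ y : ℂ)) := Complex.ofRealCLM.contDiff.comp hφ
  set ψ : SchwartzMap E6 ℂ := hc'.toSchwartzMap hφ' with hψ
  have e1 : ∀ F : E6 → ℂ, ∫ x, φ x • F x = ∫ x, F x * ψ x := fun F => by
    refine integral_congr_ae (Filter.Eventually.of_forall fun x => ?_)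
    change φ x • F x = F x * (φ x : ℂ)
    rw [Complex.real_smul, mul_comm]
  -- Self-adjointness is used twice to move both transforms onto the test function. The reflection
  -- `x ↦ -x` in between turns `𝓕⁻ h` into `𝓕 h`, and inversion is then needed only for the Schwartz
  -- function `ψ`.
  rw [e1, e1, integral_fourier_mul_eq hf ψ.integrable]
  have h2 : Integrable (fun x => 𝓕 (ψ : E6 → ℂ) (-x)) := by
    have := (𝓕 ψ).integrable (μ := (volume : Measure E6))
    exact this.comp_neg
  have e2 : ∫ x, 𝓕⁻ h x * 𝓕 (ψ : E6 → ℂ) x = ∫ x, 𝓕 h x * 𝓕 (ψ : E6 → ℂ) (-x) := by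
    rw [← integral_neg_eq_self]
    simp only [Real.fourierInv_eq_fourier_neg, neg_neg]
  rw [e2, integral_fourier_mul_eq hh h2]
  congr 1
  ext x
  congr 1
  rw [← Real.fourierInv_eq_fourier_comp_neg (𝓕 (ψ : E6 → ℂ))]
  exact congrFun (ψ.continuous.fourierInv_fourier_eq ψ.integrable (𝓕 ψ).integrable) x

/-- Two integrable functions with the same inverse Fourier transform coincide a.e. -/
lemma ae_eq_zero_of_fourierInv_eq_zero {h : E6 → ℂ} (hh : Integrable h)
    (hf : ∀ x, 𝓕⁻ h x = 0) : h =ᵐ[volume] 0 := by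
  have h0 : 𝓕⁻ h = fun _ => 0 := funext hf
  have h1 := fourier_fourierInv_ae_eq hh (by rw [h0]; exact integrable_zero _ _ _)
  refine h1.symm.trans (Filter.Eventually.of_forall fun x => ?_)
  rw [h0, Real.fourier_eq]
  simp

lemma synth_injective {σ : ℝ} (hσ : 3 < σ) : Function.Injective (synth hσ) := by
  refine (injective_iff_map_eq_zero _).2 fun g hg => ?_
  have h := ae_eq_zero_of_fourierInv_eq_zero
    (integrable_besselWeight_mul hσ (Lp.memLp g)) fun x => by
      rw [← synth_eq hσ, hg]; rfl
  rw [Lp.eq_zero_iff_ae_eq_zero]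
  filter_upwards [h] with ξ hξ
  have : (besselWeight (-σ) ξ : ℂ) ≠ 0 := by exact_mod_cast (besselWeight_pos (-σ) ξ).ne'
  simpa [this] using hξ

/-- Riemann–Lebesgue. In `ℂ ⊕ H^σ` it allows the constant to be read off from the pointwise values.
-/
lemma synth_tendsto_zero {σ : ℝ} (hσ : 3 < σ) (g : Lp ℂ 2 (volume : Measure E6)) :
    Filter.Tendsto (synth hσ g) (Filter.cocompact E6) (𝓝 0) := by
  have h1 : Filter.Tendsto (𝓕 (fun ξ => (besselWeight (-σ) ξ : ℂ) * g ξ))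
      (Filter.cocompact E6) (𝓝 0) := tendsto_integral_exp_inner_smul_cocompact _
  have h2 := h1.comp (Homeomorph.neg E6).isClosedEmbedding.tendsto_cocompact
  rw [synth_eq]
  refine h2.congr fun x => ?_
  simp [Real.fourierInv_eq_fourier_neg]

/-! ### The two descriptions of `H^σ` -/

lemma besselFourier_eq (σ : ℝ) (f : E6 → ℝ) (ξ : E6) :
    besselFourier σ f ξ = (besselWeight σ ξ : ℂ) * 𝓕 (fun y : E6 => (f y : ℂ)) ξ := rfl

lemma besselWeight_neg_mul_cancel (σ : ℝ) (ξ : E6) (z : ℂ) :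
    (besselWeight (-σ) ξ : ℂ) * ((besselWeight σ ξ : ℂ) * z) = z := by
  rw [← mul_assoc, ← Complex.ofReal_mul, besselWeight_mul]
  simp [besselWeight_zero]

lemma besselWeight_mul_neg_cancel (σ : ℝ) (ξ : E6) (z : ℂ) :
    (besselWeight σ ξ : ℂ) * ((besselWeight (-σ) ξ : ℂ) * z) = z := by
  rw [← mul_assoc, ← Complex.ofReal_mul, besselWeight_mul]
  simp [besselWeight_zero]

/-- The transform of `f` is a negative weight times an `L²` function, hence integrable, so ordinary
Fourier inversion applies. With the converse `besselFourier_ae_eq_of_synth`, the whole `H^σ`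
calculus can be carried out on the `L²` side. -/
lemma synth_besselFourier {σ : ℝ} (hσ : 3 < σ) {f : E6 → ℝ} (hf : Continuous f)
    (hc : HasCompactSupport f) (h : MemHsEuclidean σ f) (y : E6) :
    synth hσ (h.toLp (besselFourier σ f)) y = (f y : ℂ) := by
  have hcc : HasCompactSupport (fun y : E6 => (f y : ℂ)) :=
    hc.comp_left (g := Complex.ofReal) Complex.ofReal_zero
  have hfc : Continuous (fun y : E6 => (f y : ℂ)) := Complex.continuous_ofReal.comp hf
  have hint : Integrable (fun y : E6 => (f y : ℂ)) := hfc.integrable_of_hasCompactSupport hcc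
  have e : (fun ξ => (besselWeight (-σ) ξ : ℂ) * besselFourier σ f ξ)
      = 𝓕 (fun y : E6 => (f y : ℂ)) := by
    ext ξ
    rw [besselFourier_eq, besselWeight_neg_mul_cancel]
  have hi : Integrable (𝓕 (fun y : E6 => (f y : ℂ))) := by
    rw [← e]
    exact integrable_besselWeight_mul hσ h
  have e2 := synth_toLp hσ (g := besselFourier σ f) h
  rw [e] at e2
  exact (congrFun e2 y).trans (congrFun (hfc.fourierInv_fourier_eq hint hi) y)

lemma besselFourier_ae_eq_of_synth {σ : ℝ} (hσ : 3 < σ) {f : E6 → ℝ}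
    (hc : HasCompactSupport f) {g : Lp ℂ 2 (volume : Measure E6)}
    (h : ∀ y, synth hσ g y = (f y : ℂ)) : besselFourier σ f =ᵐ[volume] g := by
  have hcc : HasCompactSupport (fun y : E6 => (f y : ℂ)) :=
    hc.comp_left (g := Complex.ofReal) Complex.ofReal_zero
  have hg := integrable_besselWeight_mul hσ (Lp.memLp g)
  have e : 𝓕⁻ (fun ξ => (besselWeight (-σ) ξ : ℂ) * g ξ) = fun y : E6 => (f y : ℂ) := by
    rw [← synth_eq hσ]
    exact funext h
  have hfc : Continuous (fun y : E6 => (f y : ℂ)) := by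
    rw [← funext h]
    exact (synth hσ g).continuous
  have h1 := fourier_fourierInv_ae_eq hg (by
    rw [e]; exact hfc.integrable_of_hasCompactSupport hcc)
  rw [e] at h1
  filter_upwards [h1] with ξ hξ
  rw [besselFourier_eq, hξ, besselWeight_mul_neg_cancel]

lemma memHsEuclidean_of_synth {σ : ℝ} (hσ : 3 < σ) {f : E6 → ℝ}
    (hc : HasCompactSupport f) {g : Lp ℂ 2 (volume : Measure E6)}
    (h : ∀ y, synth hσ g y = (f y : ℂ)) : MemHsEuclidean σ f :=
  (memLp_congr_ae (besselFourier_ae_eq_of_synth hσ hc h)).2 (Lp.memLp g)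

lemma toLp_besselFourier_of_synth {σ : ℝ} (hσ : 3 < σ) {f : E6 → ℝ}
    (hc : HasCompactSupport f) {g : Lp ℂ 2 (volume : Measure E6)}
    (h : ∀ y, synth hσ g y = (f y : ℂ)) (hm : MemHsEuclidean σ f) :
    hm.toLp (besselFourier σ f) = g := by
  rw [← Lp.toLp_coeFn g (Lp.memLp g)]
  exact MemLp.toLp_eq_toLp_iff _ _ |>.2 (besselFourier_ae_eq_of_synth hσ hc h)

/-- Every Schwartz function is synthesized from an `L²` function. -/
lemma exists_synth_eq_schwartz {σ : ℝ} (hσ : 3 < σ) (f : SchwartzMap E6 ℂ) :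
    ∃ g, ∀ y, synth hσ g y = f y := by
  have h3 : Function.HasTemperateGrowth (fun ξ : E6 => (besselWeight σ ξ : ℂ)) := by
    unfold besselWeight
    fun_prop
  have h4 := (SchwartzMap.smulLeftCLM ℂ (fun ξ : E6 => (besselWeight σ ξ : ℂ))
    (𝓕 f)).memLp 2 (volume : Measure E6)
  refine ⟨h4.toLp _, fun y => ?_⟩
  rw [synth_toLp]
  have e : (fun ξ => (besselWeight (-σ) ξ : ℂ) * SchwartzMap.smulLeftCLM ℂ
      (fun ξ : E6 => (besselWeight σ ξ : ℂ)) (𝓕 f) ξ) = 𝓕 (f : E6 → ℂ) := by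
    ext ξ
    rw [SchwartzMap.smulLeftCLM_apply_apply h3, smul_eq_mul, besselWeight_neg_mul_cancel]
    rfl
  rw [e]
  exact congrFun (f.continuous.fourierInv_fourier_eq f.integrable (𝓕 f).integrable) y

/-- The functions synthesized from Schwartz functions are dense in `H^σ`. -/
lemma dense_synth_schwartz {σ : ℝ} (hσ : 3 < σ) :
    Dense {g : Lp ℂ 2 (volume : Measure E6) | ∃ f : SchwartzMap E6 ℂ, ∀ y, synth hσ g y = f y} := by
  have h := SchwartzMap.denseRange_toLpCLM (E := E6) (F := ℂ) (p := 2) (by norm_num)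
    (μ := (volume : Measure E6))
  refine h.mono ?_
  rintro _ ⟨φ, rfl⟩
  have h3 : Function.HasTemperateGrowth (fun ξ : E6 => (besselWeight (-σ) ξ : ℂ)) := by
    unfold besselWeight
    fun_prop
  -- Schwartz functions are dense in `L²`, and the weight has temperate growth, so `synth` maps each
  -- of them to a Schwartz function.
  refine ⟨𝓕⁻ (SchwartzMap.smulLeftCLM ℂ (fun ξ : E6 => (besselWeight (-σ) ξ : ℂ)) φ), fun y => ?_⟩
  have e : (SchwartzMap.smulLeftCLM ℂ (fun ξ : E6 => (besselWeight (-σ) ξ : ℂ)) φ : E6 → ℂ)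
      = fun ξ => (besselWeight (-σ) ξ : ℂ) * φ ξ := by
    ext ξ
    rw [SchwartzMap.smulLeftCLM_apply_apply h3, smul_eq_mul]
  rw [SchwartzMap.fourierInv_coe, e]
  exact congrFun (synth_toLp hσ (φ.memLp 2 volume)) y

/-! ### Products -/

/-- Young's inequality `L¹ * L² ⊂ L²`. -/
lemma eLpNorm_lconvolution_le {a b : E6 → ℝ≥0∞} (ha : AEMeasurable a) (hb : AEMeasurable b) :
    eLpNorm (a ⋆ₗ b) 2 volume ≤ (∫⁻ x, a x) * eLpNorm b 2 volume := by
  have key : ∀ x, (a ⋆ₗ b) x ^ (2 : ℝ) ≤ (∫⁻ y, a y) * ∫⁻ y, a y * b (-y + x) ^ (2 : ℝ) := by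
    intro x
    have hbx : AEMeasurable (fun y => b (-y + x)) := by fun_prop
    -- Cauchy–Schwarz with the splitting `a·b = a^{1/2}·(a^{1/2} b)`.
    have h := ENNReal.lintegral_mul_le_Lp_mul_Lq (volume : Measure E6)
      (p := 2) (q := 2) Real.HolderConjugate.two_two
      (f := fun y => a y ^ (1 / 2 : ℝ)) (g := fun y => a y ^ (1 / 2 : ℝ) * b (-y + x))
      (by fun_prop) (by fun_prop)
    have e1 : ∀ y, a y ^ (1 / 2 : ℝ) * (a y ^ (1 / 2 : ℝ) * b (-y + x)) = a y * b (-y + x) := by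
      intro y
      rw [← mul_assoc, ← ENNReal.rpow_add_of_nonneg _ _ (by norm_num) (by norm_num)]
      norm_num
    have e2 : ∀ y, (a y ^ (1 / 2 : ℝ)) ^ (2 : ℝ) = a y := by
      intro y
      rw [← ENNReal.rpow_mul]
      norm_num
    simp only [Pi.mul_apply, e1, ENNReal.mul_rpow_of_nonneg _ _ (zero_le_two : (0 : ℝ) ≤ 2), e2] at h
    calc (a ⋆ₗ b) x ^ (2 : ℝ)
        ≤ ((∫⁻ y, a y) ^ (1 / 2 : ℝ) * (∫⁻ y, a y * b (-y + x) ^ (2 : ℝ)) ^ (1 / 2 : ℝ))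
            ^ (2 : ℝ) := ENNReal.rpow_le_rpow h (by norm_num)
      _ = _ := by
        rw [ENNReal.mul_rpow_of_nonneg _ _ (by norm_num), ← ENNReal.rpow_mul, ← ENNReal.rpow_mul]
        norm_num
  have h2 : ∫⁻ x, (a ⋆ₗ b) x ^ (2 : ℝ) ≤ (∫⁻ y, a y) ^ (2 : ℝ) * ∫⁻ y, b y ^ (2 : ℝ) := by
    calc ∫⁻ x, (a ⋆ₗ b) x ^ (2 : ℝ)
        ≤ ∫⁻ x, (∫⁻ y, a y) * ∫⁻ y, a y * b (-y + x) ^ (2 : ℝ) := lintegral_mono key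
      _ = (∫⁻ y, a y) * ∫⁻ x, ∫⁻ y, a y * b (-y + x) ^ (2 : ℝ) := by
        rw [lintegral_const_mul'']
        have : AEMeasurable (fun p : E6 × E6 => a p.2 * b (-p.2 + p.1) ^ (2 : ℝ))
            (volume.prod volume) := by fun_prop
        exact this.lintegral_prod_right'
      _ = (∫⁻ y, a y) * ∫⁻ y, ∫⁻ x, a y * b (-y + x) ^ (2 : ℝ) := by
        rw [lintegral_lintegral_swap]
        simpa [Function.uncurry_def] using by fun_prop
      _ = (∫⁻ y, a y) * ∫⁻ y, a y * ∫⁻ x, b x ^ (2 : ℝ) := by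
        congr 1
        refine lintegral_congr fun y => ?_
        rw [lintegral_const_mul'' _ (by fun_prop),
          lintegral_add_left_eq_self (fun x => b x ^ (2 : ℝ)) (-y)]
      _ = _ := by
        rw [lintegral_mul_const'' _ ha, ← mul_assoc]
        congr 1
        rw [show (2 : ℝ) = 1 + 1 by norm_num,
          ENNReal.rpow_add_of_nonneg _ _ (by norm_num) (by norm_num), ENNReal.rpow_one]
  rw [eLpNorm_eq_lintegral_rpow_enorm_toReal (by norm_num) (by norm_num),
    eLpNorm_eq_lintegral_rpow_enorm_toReal (by norm_num) (by norm_num)]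
  simp only [enorm_eq_self, ENNReal.toReal_ofNat]
  refine (ENNReal.rpow_le_rpow h2 (by norm_num)).trans (le_of_eq ?_)
  rw [ENNReal.mul_rpow_of_nonneg _ _ (by norm_num), ← ENNReal.rpow_mul]
  norm_num

lemma lintegral_enorm_besselWeight_mul_le {σ : ℝ} {g : E6 → ℂ} (hg : MemLp g 2 volume) :
    ∫⁻ ξ, ‖(besselWeight (-σ) ξ : ℂ) * g ξ‖ₑ
      ≤ eLpNorm (fun ξ : E6 => (besselWeight (-σ) ξ : ℂ)) 2 volume * eLpNorm g 2 volume := by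
  have hc : Continuous (fun ξ : E6 => (besselWeight (-σ) ξ : ℂ)) :=
    Complex.continuous_ofReal.comp (continuous_besselWeight _)
  have h := eLpNorm_smul_le_mul_eLpNorm (r := 1) (p := 2) (q := 2) hg.1 hc.aestronglyMeasurable
  rw [eLpNorm_one_eq_lintegral_enorm] at h
  exact h

lemma enorm_besselWeight (σ : ℝ) (ξ : E6) :
    ‖(besselWeight σ ξ : ℂ)‖ₑ = ENNReal.ofReal (besselWeight σ ξ) := by
  rw [← ofReal_norm, Complex.norm_real, Real.norm_of_nonneg (besselWeight_pos _ _).le]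

/-- The weight is submultiplicative up to a constant, and so it can be moved inside a
convolution. -/
lemma enorm_besselWeight_mul_convolution_le {σ : ℝ} (hσ : 0 ≤ σ) {g h G H : E6 → ℂ}
    (hg : AEStronglyMeasurable g volume) (hH : AEStronglyMeasurable H volume)
    (hGg : ∀ ξ, G ξ = (besselWeight (-σ) ξ : ℂ) * g ξ)
    (hHh : ∀ ξ, H ξ = (besselWeight (-σ) ξ : ℂ) * h ξ) (ξ : E6) :
    ‖(besselWeight σ ξ : ℂ) * convolution G H (ContinuousLinearMap.mul ℂ ℂ) volume ξ‖ₑ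
      ≤ ENNReal.ofReal (4 ^ (σ / 2)) * (((fun ξ => ‖g ξ‖ₑ) ⋆ₗ (fun ξ => ‖H ξ‖ₑ)) ξ
        + ((fun ξ => ‖G ξ‖ₑ) ⋆ₗ (fun ξ => ‖h ξ‖ₑ)) ξ) := by
  have cancel : ∀ (f F : E6 → ℂ) (_ : ∀ ξ, F ξ = (besselWeight (-σ) ξ : ℂ) * f ξ) (ξ : E6),
      ENNReal.ofReal (besselWeight σ ξ) * ‖F ξ‖ₑ = ‖f ξ‖ₑ := by
    intro f F hF ξ
    rw [← enorm_besselWeight, ← enorm_mul, hF, besselWeight_mul_neg_cancel]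
  have gen : ∀ c a b x y p q : ℝ≥0∞, a * x = p → b * y = q →
      c * (a + b) * (x * y) = c * (p * y + x * q) := by
    rintro c a b x y p q rfl rfl
    ring
  -- The weight inequality for `ξ = η + (ξ - η)`, the two frequencies that meet in the convolution.
  have hbd : ∀ η, ENNReal.ofReal (besselWeight σ ξ) ≤ ENNReal.ofReal (4 ^ (σ / 2)) *
      (ENNReal.ofReal (besselWeight σ η) + ENNReal.ofReal (besselWeight σ (-η + ξ))) := by
    intro η
    rw [← ENNReal.ofReal_add (besselWeight_pos _ _).le (besselWeight_pos _ _).le,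
      ← ENNReal.ofReal_mul (by positivity)]
    refine ENNReal.ofReal_le_ofReal ?_
    have := besselWeight_add_le hσ η (-η + ξ)
    simpa using this
  have hm : AEMeasurable (fun η => ‖g η‖ₑ * ‖H (-η + ξ)‖ₑ) := by
    refine hg.enorm.mul ?_
    simp only [neg_add_eq_sub]
    exact hH.enorm.comp_quasiMeasurePreserving (quasiMeasurePreserving_sub_left volume ξ)
  calc _ ≤ ENNReal.ofReal (besselWeight σ ξ) * ∫⁻ η, ‖G η‖ₑ * ‖H (-η + ξ)‖ₑ := by
        rw [enorm_mul, enorm_besselWeight]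
        refine mul_le_mul_right ?_ _
        refine (enorm_integral_le_lintegral_enorm _).trans (le_of_eq ?_)
        refine lintegral_congr fun η => ?_
        rw [ContinuousLinearMap.mul_apply', enorm_mul, neg_add_eq_sub]
    _ = ∫⁻ η, ENNReal.ofReal (besselWeight σ ξ) * (‖G η‖ₑ * ‖H (-η + ξ)‖ₑ) := by
        rw [lintegral_const_mul' _ _ ENNReal.ofReal_ne_top]
    _ ≤ ∫⁻ η, ENNReal.ofReal (4 ^ (σ / 2)) *
          (‖g η‖ₑ * ‖H (-η + ξ)‖ₑ + ‖G η‖ₑ * ‖h (-η + ξ)‖ₑ) := by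
        refine lintegral_mono fun η => ?_
        have e := gen (ENNReal.ofReal (4 ^ (σ / 2))) _ _ ‖G η‖ₑ ‖H (-η + ξ)‖ₑ _ _
          (cancel g G hGg η) (cancel h H hHh (-η + ξ))
        rw [← e]
        exact mul_le_mul_left (hbd η) _
    _ = _ := by
        rw [lintegral_const_mul' _ _ ENNReal.ofReal_ne_top, lintegral_add_left' hm]
        rfl

/-- Once the weight has been distributed, each of the two convolutions pairs an `L²` function with
one in `L¹`, so Young's inequality bounds both. -/
lemma eLpNorm_besselWeight_mul_convolution_le {σ : ℝ} (hσ : 3 < σ) {g h G H : E6 → ℂ}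
    (hg : MemLp g 2 volume) (hh : MemLp h 2 volume)
    (hGg : ∀ ξ, G ξ = (besselWeight (-σ) ξ : ℂ) * g ξ)
    (hHh : ∀ ξ, H ξ = (besselWeight (-σ) ξ : ℂ) * h ξ) :
    eLpNorm (fun ξ => (besselWeight σ ξ : ℂ) *
        convolution G H (ContinuousLinearMap.mul ℂ ℂ) volume ξ) 2 volume
      ≤ ENNReal.ofReal (4 ^ (σ / 2)) * (2 * (eLpNorm (fun ξ : E6 => (besselWeight (-σ) ξ : ℂ)) 2
        volume * (eLpNorm g 2 volume * eLpNorm h 2 volume))) := by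
  obtain rfl : G = fun ξ => (besselWeight (-σ) ξ : ℂ) * g ξ := funext hGg
  obtain rfl : H = fun ξ => (besselWeight (-σ) ξ : ℂ) * h ξ := funext hHh
  have iG := integrable_besselWeight_mul hσ hg
  have iH := integrable_besselWeight_mul hσ hh
  have mg : AEMeasurable (fun ξ => ‖g ξ‖ₑ) := hg.1.enorm
  have mh : AEMeasurable (fun ξ => ‖h ξ‖ₑ) := hh.1.enorm
  have mG := iG.1.enorm
  have mH := iH.1.enorm
  have nA := (eLpNorm_lconvolution_le mH mg).trans
    (mul_le_mul_left (lintegral_enorm_besselWeight_mul_le hh) _)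
  have nB := (eLpNorm_lconvolution_le mG mh).trans
    (mul_le_mul_left (lintegral_enorm_besselWeight_mul_le hg) _)
  -- Young's inequality has the `L¹` factor on the left, whereas in the first convolution it stands
  -- on the right.
  rw [lconvolution_comm] at nA
  rw [eLpNorm_enorm] at nA nB
  have mA := (aemeasurable_lconvolution mg mH).aestronglyMeasurable
  have mB := (aemeasurable_lconvolution mG mh).aestronglyMeasurable
  have hb := enorm_besselWeight_mul_convolution_le (σ := σ) (by linarith) hg.1 iH.1 hGg hHh
  refine (eLpNorm_le_nnreal_smul_eLpNorm_of_ae_le_mul' (c := Real.toNNReal (4 ^ (σ / 2)))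
    (g := ((fun ξ => ‖g ξ‖ₑ) ⋆ₗ fun ξ => ‖(besselWeight (-σ) ξ : ℂ) * h ξ‖ₑ) +
      ((fun ξ => ‖(besselWeight (-σ) ξ : ℂ) * g ξ‖ₑ) ⋆ₗ fun ξ => ‖h ξ‖ₑ))
    (Filter.Eventually.of_forall hb) 2).trans ?_
  rw [ENNReal.smul_def, smul_eq_mul]
  refine mul_le_mul_right ((eLpNorm_add_le mA mB (by norm_num)).trans ?_) _
  rw [two_mul]
  refine add_le_add (nA.trans (le_of_eq ?_)) (nB.trans (le_of_eq ?_)) <;> ring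

/-- `H^σ` is an algebra for `σ > 3`. -/
lemma exists_synth_mul {σ : ℝ} (hσ : 3 < σ) :
    ∃ K : ℝ, 0 < K ∧ ∀ g h : Lp ℂ 2 (volume : Measure E6), ∃ k : Lp ℂ 2 (volume : Measure E6),
      (∀ y, synth hσ k y = synth hσ g y * synth hσ h y) ∧ ‖k‖ ≤ K * (‖g‖ * ‖h‖) := by
  have hw := (memLp_besselWeight_neg hσ).2.ne
  set w : ℝ≥0∞ := eLpNorm (fun ξ : E6 => (besselWeight (-σ) ξ : ℂ)) 2 volume
  -- The summand 1 makes the constant positive without a lower bound for `w`; the constant is later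
  -- inverted.
  refine ⟨4 ^ (σ / 2) * (2 * w.toReal) + 1, by positivity, fun g h => ?_⟩
  have iG := integrable_besselWeight_mul hσ (Lp.memLp g)
  have iH := integrable_besselWeight_mul hσ (Lp.memLp h)
  have iP := iG.integrable_convolution (ContinuousLinearMap.mul ℂ ℂ) iH
  have nk := eLpNorm_besselWeight_mul_convolution_le hσ (Lp.memLp g) (Lp.memLp h)
    (fun _ => rfl) (fun _ => rfl)
  have hfin : ENNReal.ofReal (4 ^ (σ / 2)) *
      (2 * (w * (eLpNorm g 2 volume * eLpNorm h 2 volume))) ≠ ⊤ :=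
    ENNReal.mul_ne_top ENNReal.ofReal_ne_top (ENNReal.mul_ne_top (by norm_num)
      (ENNReal.mul_ne_top hw (ENNReal.mul_ne_top (Lp.eLpNorm_ne_top _) (Lp.eLpNorm_ne_top _))))
  have mk := ((Complex.continuous_ofReal.comp
    (continuous_besselWeight σ)).aestronglyMeasurable (μ := volume)).mul iP.1
  have hkm : MemLp (fun ξ => (besselWeight σ ξ : ℂ) * convolution
      (fun ξ => (besselWeight (-σ) ξ : ℂ) * g ξ) (fun ξ => (besselWeight (-σ) ξ : ℂ) * h ξ)
      (ContinuousLinearMap.mul ℂ ℂ) volume ξ) 2 volume := ⟨mk, nk.trans_lt hfin.lt_top⟩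
  refine ⟨hkm.toLp _, fun y => ?_, ?_⟩
  · rw [synth_toLp]
    simp only [besselWeight_neg_mul_cancel]
    rw [synth_eq, synth_eq]
    simp only [Real.fourierInv_eq_fourier_neg]
    exact Real.fourier_mul_convolution_eq iG iH (-y)
  · rw [Lp.norm_toLp]
    refine (ENNReal.toReal_mono hfin nk).trans ?_
    rw [ENNReal.toReal_mul, ENNReal.toReal_mul, ENNReal.toReal_mul, ENNReal.toReal_mul,
      ENNReal.toReal_ofReal (by positivity), ENNReal.toReal_ofNat, ← Lp.norm_def, ← Lp.norm_def]
    have : 0 ≤ ‖g‖ * ‖h‖ := by positivity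
    linarith

/-! ### Derivatives and inclusions -/

/-- Multiplication of `L²` functions by a bounded function. -/
def mulBounded {m : E6 → ℂ} (hm : MemLp m ∞ volume) :
    Lp ℂ 2 (volume : Measure E6) →L[ℂ] Lp ℂ 2 (volume : Measure E6) :=
  (ContinuousLinearMap.mul ℂ ℂ).holderL volume ∞ 2 2 (hm.toLp m)

lemma coeFn_mulBounded {m : E6 → ℂ} (hm : MemLp m ∞ volume) (g : Lp ℂ 2 (volume : Measure E6)) :
    mulBounded hm g =ᵐ[volume] fun ξ => m ξ * g ξ := by
  have h := ContinuousLinearMap.coeFn_holder (r := 2) (ContinuousLinearMap.mul ℂ ℂ) (hm.toLp m) g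
  filter_upwards [h, hm.coeFn_toLp] with ξ h1 h2
  rw [show mulBounded hm g = ContinuousLinearMap.holder 2 (ContinuousLinearMap.mul ℂ ℂ)
    (hm.toLp m) g from rfl, h1, h2]
  simp

lemma memLp_top_of_continuous {m : E6 → ℂ} (hm : Continuous m) {C : ℝ} (h : ∀ ξ, ‖m ξ‖ ≤ C) :
    MemLp m ∞ volume :=
  memLp_top_of_bound hm.aestronglyMeasurable C (Filter.Eventually.of_forall h)

/-- The inclusion `H^σ ⊂ H^τ` for `τ ≤ σ`. -/
lemma exists_synth_inclusion {σ τ : ℝ} (hτ : 3 < τ) (hσ : 3 < σ) (h : τ ≤ σ) :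
    ∃ I : Lp ℂ 2 (volume : Measure E6) →L[ℂ] Lp ℂ 2 (volume : Measure E6),
      ∀ g y, synth hτ (I g) y = synth hσ g y := by
  have hm : MemLp (fun ξ : E6 => (besselWeight (τ - σ) ξ : ℂ)) ∞ volume := by
    refine memLp_top_of_continuous (Complex.continuous_ofReal.comp (continuous_besselWeight _))
      (C := 1) fun ξ => ?_
    rw [Complex.norm_real, Real.norm_of_nonneg (besselWeight_pos _ _).le, ← besselWeight_zero ξ]
    exact besselWeight_mono (by linarith) ξ
  refine ⟨mulBounded hm, fun g y => ?_⟩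
  rw [synth_eq, synth_eq]
  refine Real.fourierInv_congr_ae ?_ y
  filter_upwards [coeFn_mulBounded hm g] with ξ hξ
  rw [hξ, ← mul_assoc, ← Complex.ofReal_mul, besselWeight_mul]
  congr 3
  ring

/-- The factor `‖ξ‖ⁿ` uses up `n` units of the weight, and the remaining exponent `σ - n` still
exceeds 3. -/
lemma norm_mul_synth_integrand_integrable {σ : ℝ} (n : ℕ) (hσ : 3 + n < σ)
    (g : Lp ℂ 2 (volume : Measure E6)) :
    Integrable (fun ξ => ‖ξ‖ ^ n * ‖(besselWeight (-σ) ξ : ℂ) * g ξ‖) := by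
  have h1 := (integrable_besselWeight_mul (σ := σ - n) (by linarith) (Lp.memLp g)).norm
  refine h1.mono' ?_ (Filter.Eventually.of_forall fun ξ => ?_)
  · refine ((continuous_norm.pow n).aestronglyMeasurable).mul ?_
    exact ((Complex.continuous_ofReal.comp
      (continuous_besselWeight _)).aestronglyMeasurable.mul (Lp.memLp g).1).norm
  · rw [Real.norm_of_nonneg (by positivity), norm_mul, norm_mul, ← mul_assoc]
    refine mul_le_mul_of_nonneg_right ?_ (norm_nonneg _)
    rw [Complex.norm_real, Complex.norm_real, Real.norm_of_nonneg (besselWeight_pos _ _).le,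
      Real.norm_of_nonneg (besselWeight_pos _ _).le]
    have := mul_le_mul_of_nonneg_right (norm_pow_le_besselWeight n ξ) (besselWeight_pos (-σ) ξ).le
    rw [besselWeight_mul] at this
    refine this.trans (le_of_eq ?_)
    congr 1
    ring

lemma fourierInv_eq_fourier_comp_neg' (f : E6 → ℂ) : 𝓕⁻ f = fun y => 𝓕 f (-y) :=
  funext fun y => Real.fourierInv_eq_fourier_neg f y

/-- The Sobolev embedding `H^σ ⊂ C^n` for `σ > 3 + n`. -/
lemma contDiff_synth {σ : ℝ} (n : ℕ) (hσ3 : 3 < σ) (hσ : 3 + n < σ)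
    (g : Lp ℂ 2 (volume : Measure E6)) : ContDiff ℝ n (synth hσ3 g) := by
  rw [synth_eq, fourierInv_eq_fourier_comp_neg']
  have h : ContDiff ℝ ((n : ℕ∞) : ℕ∞ω) (𝓕 (fun ξ => (besselWeight (-σ) ξ : ℂ) * g ξ)) := by
    refine Real.contDiff_fourier fun m hm => norm_mul_synth_integrand_integrable m ?_ g
    have : (m : ℝ) ≤ n := by exact_mod_cast hm
    linarith
  exact h.comp contDiff_neg

/-- Differentiation maps `H^σ` to `H^{σ-1}`. -/
lemma exists_synth_deriv {σ : ℝ} (hσ : 3 < σ) (hσ' : 3 < σ - 1) (w : E6) :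
    ∃ I : Lp ℂ 2 (volume : Measure E6) →L[ℂ] Lp ℂ 2 (volume : Measure E6),
      ∀ g y, synth hσ' (I g) y = fderiv ℝ (synth hσ g) y w := by
  -- The symbol `2πi⟨ξ, w⟩` of `∂_w`, combined with the one unit of weight by which the exponents
  -- `σ` and `σ - 1` differ. That unit makes the multiplier bounded.
  have hm : MemLp (fun ξ : E6 => 2 * Real.pi * Complex.I * (inner ℝ ξ w : ℝ) *
      (besselWeight (-1) ξ : ℂ)) ∞ volume := by
    refine memLp_top_of_continuous (C := 2 * Real.pi * ‖w‖) ?_ fun ξ => ?_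
    · have := continuous_besselWeight (-1)
      fun_prop
    · simp only [norm_mul, Complex.norm_real, Complex.norm_I, mul_one, Complex.norm_ofNat,
        Real.norm_of_nonneg Real.pi_pos.le, Real.norm_of_nonneg (besselWeight_pos _ _).le]
      rw [mul_assoc]
      refine mul_le_mul_of_nonneg_left ?_ (by positivity)
      have h1 : ‖(inner ℝ ξ w : ℝ)‖ ≤ ‖ξ‖ * ‖w‖ := norm_inner_le_norm ξ w
      have h2 : ‖ξ‖ * besselWeight (-1) ξ ≤ 1 := by
        have := mul_le_mul_of_nonneg_right (norm_le_besselWeight_one ξ)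
          (besselWeight_pos (-1) ξ).le
        rwa [besselWeight_mul, add_neg_cancel, besselWeight_zero] at this
      have h3 := besselWeight_pos (-1) ξ
      calc ‖(inner ℝ ξ w : ℝ)‖ * besselWeight (-1) ξ ≤ ‖ξ‖ * ‖w‖ * besselWeight (-1) ξ :=
            mul_le_mul_of_nonneg_right h1 h3.le
        _ = (‖ξ‖ * besselWeight (-1) ξ) * ‖w‖ := by ring
        _ ≤ 1 * ‖w‖ := mul_le_mul_of_nonneg_right h2 (norm_nonneg _)
        _ = ‖w‖ := one_mul _
  refine ⟨mulBounded hm, fun g y => ?_⟩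
  set f : E6 → ℂ := fun ξ => (besselWeight (-σ) ξ : ℂ) * g ξ with hf
  have i0 : Integrable f := integrable_besselWeight_mul hσ (Lp.memLp g)
  have i1 : Integrable (fun ξ => ‖ξ‖ * ‖f ξ‖) := by
    have := norm_mul_synth_integrand_integrable (σ := σ) 1 (by norm_num; linarith) g
    simp only [pow_one] at this
    exact this
  have hd := Real.hasFDerivAt_fourier i0 i1 (-y)
  have hd2 : HasFDerivAt (synth hσ g) ((𝓕 (VectorFourier.fourierSMulRight (innerSL ℝ) f) (-y)).comp
      (-ContinuousLinearMap.id ℝ E6)) y := by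
    rw [synth_eq, fourierInv_eq_fourier_comp_neg']
    exact hd.comp y (hasFDerivAt_id y).neg
  have iS : Integrable (VectorFourier.fourierSMulRight (innerSL ℝ) f) := by
    refine (i1.const_mul (2 * Real.pi * ‖innerSL ℝ (E := E6)‖)).mono'
      i0.1.fourierSMulRight (Filter.Eventually.of_forall fun ξ => ?_)
    refine (VectorFourier.norm_fourierSMulRight_le _ _ _).trans (le_of_eq ?_)
    ring
  rw [hd2.fderiv, synth_eq, ContinuousLinearMap.comp_apply,
    Real.fourier_continuousLinearMap_apply iS, Real.fourierInv_eq_fourier_neg]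
  refine Real.fourier_congr_ae ?_ _
  filter_upwards [coeFn_mulBounded hm g] with ξ hξ
  rw [hξ, VectorFourier.fourierSMulRight_apply]
  simp only [neg_apply, ContinuousLinearMap.id_apply, map_neg, hf]
  rw [show (besselWeight (-σ) ξ : ℂ) = besselWeight (-(σ - 1)) ξ * besselWeight (-1) ξ by
    rw [← Complex.ofReal_mul, besselWeight_mul]; congr 2; ring]
  change _ = -(2 * (Real.pi : ℂ) * Complex.I) • (-(inner ℝ ξ w : ℝ)) • _
  simp only [smul_eq_mul, Complex.real_smul]
  push_cast
  ring

/-! ### Cut-off functions -/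

lemma exists_smooth_cutoff {K U : Set E6} (hK : IsCompact K) (hU : IsOpen U) (hKU : K ⊆ U) :
    ∃ θ : E6 → ℝ, ContDiff ℝ ∞ θ ∧ HasCompactSupport θ ∧ tsupport θ ⊆ U ∧
      (∀ y ∈ K, θ y = 1) ∧ ∀ y, θ y ∈ Icc (0 : ℝ) 1 := by
  obtain ⟨L, hL, hKL, hLU⟩ := exists_compact_between hK hU hKU
  obtain ⟨f, h1, h0, h01⟩ := exists_contMDiffMap_one_nhds_of_subset_interior (n := (⊤ : ℕ∞)) 𝓘(ℝ, E6)
    hK.isClosed hKL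
  have hsupp : tsupport f ⊆ L := by
    refine closure_minimal (fun y hy => ?_) hL.isClosed
    by_contra hyL
    exact hy (h0 y hyL)
  exact ⟨f, f.contMDiff.contDiff, hL.of_isClosed_subset (isClosed_tsupport _) hsupp,
    hsupp.trans hLU, fun y hy => h1.self_of_nhdsSet y hy, h01⟩

/-! ### The Banach algebra `ℂ ⊕ H^σ(ℝ⁶)` -/

/-- The algebra constant of `H^σ`. -/
def mulConst {σ : ℝ} (hσ : 3 < σ) : ℝ := (exists_synth_mul hσ).choose

lemma mulConst_pos {σ : ℝ} (hσ : 3 < σ) : 0 < mulConst hσ := (exists_synth_mul hσ).choose_spec.1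

lemma mulConst_ne_zero {σ : ℝ} (hσ : 3 < σ) : (mulConst hσ : ℂ) ≠ 0 := by
  exact_mod_cast (mulConst_pos hσ).ne.symm

/-- The product of `H^σ`, on the Fourier side. -/
def synthMul {σ : ℝ} (hσ : 3 < σ) (g h : Lp ℂ 2 (volume : Measure E6)) :
    Lp ℂ 2 (volume : Measure E6) := ((exists_synth_mul hσ).choose_spec.2 g h).choose

lemma synth_synthMul {σ : ℝ} (hσ : 3 < σ) (g h : Lp ℂ 2 (volume : Measure E6)) (y : E6) :
    synth hσ (synthMul hσ g h) y = synth hσ g y * synth hσ h y :=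
  ((exists_synth_mul hσ).choose_spec.2 g h).choose_spec.1 y

lemma norm_synthMul_le {σ : ℝ} (hσ : 3 < σ) (g h : Lp ℂ 2 (volume : Measure E6)) :
    ‖synthMul hσ g h‖ ≤ mulConst hσ * (‖g‖ * ‖h‖) :=
  ((exists_synth_mul hσ).choose_spec.2 g h).choose_spec.2

/-- The algebra `ℂ ⊕ H^σ(ℝ⁶)`; the norm of `H^σ` is multiplied by the algebra constant. -/
def HsAlg {σ : ℝ} (_hσ : 3 < σ) : Type := WithLp 1 (ℂ × Lp ℂ 2 (volume : Measure E6))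

namespace HsAlg

variable {σ : ℝ} {hσ : 3 < σ}

instance : NormedAddCommGroup (HsAlg hσ) :=
  inferInstanceAs (NormedAddCommGroup (WithLp 1 (ℂ × Lp ℂ 2 (volume : Measure E6))))

instance : NormedSpace ℂ (HsAlg hσ) :=
  inferInstanceAs (NormedSpace ℂ (WithLp 1 (ℂ × Lp ℂ 2 (volume : Measure E6))))

instance : CompleteSpace (HsAlg hσ) :=
  inferInstanceAs (CompleteSpace (WithLp 1 (ℂ × Lp ℂ 2 (volume : Measure E6))))

/-- The value at infinity. -/
def const : HsAlg hσ →L[ℂ] ℂ := WithLp.fstL 1 ℂ ℂ (Lp ℂ 2 (volume : Measure E6))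

/-- The (normalized) component in `H^σ`. -/
def tail : HsAlg hσ →L[ℂ] Lp ℂ 2 (volume : Measure E6) :=
  WithLp.sndL 1 ℂ ℂ (Lp ℂ 2 (volume : Measure E6))

/-- The element with given components. -/
def mk (c : ℂ) (g : Lp ℂ 2 (volume : Measure E6)) : HsAlg hσ := WithLp.toLp 1 (c, g)

@[simp] lemma const_mk (c : ℂ) (g : Lp ℂ 2 (volume : Measure E6)) :
    const (mk c g : HsAlg hσ) = c := rfl

@[simp] lemma tail_mk (c : ℂ) (g : Lp ℂ 2 (volume : Measure E6)) :
    tail (mk c g : HsAlg hσ) = g := rfl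

lemma ext' {a b : HsAlg hσ} (h1 : const a = const b) (h2 : tail a = tail b) : a = b :=
  (WithLp.equiv 1 _).injective (Prod.ext h1 h2)

lemma norm_eq (a : HsAlg hσ) : ‖a‖ = ‖const a‖ + ‖tail a‖ := WithLp.prod_norm_eq_of_L1 a

/-- The value of an element of `ℂ ⊕ H^σ` at a point. -/
def eval (y : E6) : HsAlg hσ →L[ℂ] ℂ :=
  const + (mulConst hσ : ℂ)⁻¹ • ((BoundedContinuousFunction.evalCLM ℂ y).comp
    ((synth hσ).comp tail))

lemma eval_apply (a : HsAlg hσ) (y : E6) :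
    eval y a = const a + (mulConst hσ : ℂ)⁻¹ * synth hσ (tail a) y := rfl

lemma continuous_eval (a : HsAlg hσ) : Continuous fun y => eval y a := by
  simp only [eval_apply]
  fun_prop

lemma tendsto_eval (a : HsAlg hσ) :
    Filter.Tendsto (fun y => eval y a) (Filter.cocompact E6) (𝓝 (const a)) := by
  simp only [eval_apply]
  simpa using ((synth_tendsto_zero hσ (tail a)).const_mul (mulConst hσ : ℂ)⁻¹).const_add (const a)

/-- The constant is the limit at infinity, and the rest follows from the injectivity of `synth`.
Identities in the algebra, in particular the ring axioms, thereby reduce to pointwise identities. -/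
lemma eval_ext {a b : HsAlg hσ} (h : ∀ y, eval y a = eval y b) : a = b := by
  have h1 : const a = const b := tendsto_nhds_unique (tendsto_eval a)
    ((tendsto_eval b).congr fun y => (h y).symm)
  refine ext' h1 (synth_injective hσ (BoundedContinuousFunction.ext fun y => ?_))
  have := h y
  rw [eval_apply, eval_apply, h1] at this
  exact mul_left_cancel₀ (inv_ne_zero (mulConst_ne_zero hσ)) (add_left_cancel this)

lemma const_eq_zero_of_hasCompactSupport {a : HsAlg hσ}
    (h : HasCompactSupport fun y => eval y a) : const a = 0 :=
  tendsto_nhds_unique (tendsto_eval a) h.is_zero_at_infty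

/-- With `K = mulConst hσ`, the pair `(c, g)` stands for the function `c + K⁻¹·synth g`. Expanding a
product leaves one factor `K⁻¹` in front of `synthMul`, which absorbs the algebra constant and makes
the norm submultiplicative. -/
instance : Mul (HsAlg hσ) where
  mul a b := mk (const a * const b) (const a • tail b + const b • tail a +
    (mulConst hσ : ℂ)⁻¹ • synthMul hσ (tail a) (tail b))

instance : One (HsAlg hσ) where
  one := mk 1 0

lemma mul_def (a b : HsAlg hσ) : a * b = mk (const a * const b) (const a • tail b +
    const b • tail a + (mulConst hσ : ℂ)⁻¹ • synthMul hσ (tail a) (tail b)) := rfl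

@[simp] lemma const_one : const (1 : HsAlg hσ) = 1 := rfl

@[simp] lemma tail_one : tail (1 : HsAlg hσ) = 0 := rfl

@[simp] lemma eval_one (y : E6) : eval y (1 : HsAlg hσ) = 1 := by
  simp [eval_apply]

@[simp] lemma eval_mul (a b : HsAlg hσ) (y : E6) : eval y (a * b) = eval y a * eval y b := by
  simp only [mul_def, eval_apply, const_mk, tail_mk, map_add, map_smul,
    BoundedContinuousFunction.coe_add, BoundedContinuousFunction.coe_smul, Pi.add_apply,
    synth_synthMul, smul_eq_mul]
  ring

lemma norm_mul_le' (a b : HsAlg hσ) : ‖a * b‖ ≤ ‖a‖ * ‖b‖ := by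
  rw [norm_eq, norm_eq a, norm_eq b, mul_def, const_mk, tail_mk, norm_mul]
  have hK := mulConst_pos hσ
  have h1 : ‖(mulConst hσ : ℂ)⁻¹ • synthMul hσ (tail a) (tail b)‖ ≤ ‖tail a‖ * ‖tail b‖ := by
    rw [norm_smul, norm_inv, Complex.norm_real, Real.norm_of_nonneg hK.le, inv_mul_le_iff₀ hK]
    exact norm_synthMul_le hσ _ _
  have h2 := norm_add₃_le (a := const a • tail b) (b := const b • tail a)
    (c := (mulConst hσ : ℂ)⁻¹ • synthMul hσ (tail a) (tail b))
  rw [norm_smul, norm_smul] at h2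
  nlinarith

instance : NormedCommRing (HsAlg hσ) where
  __ := (inferInstance : NormedAddCommGroup (HsAlg hσ))
  mul := (· * ·)
  one := 1
  left_distrib a b c := eval_ext fun y => by
    change eval y (a * (b + c)) = eval y (a * b + a * c)
    simp only [eval_mul, map_add]; ring
  right_distrib a b c := eval_ext fun y => by
    change eval y ((a + b) * c) = eval y (a * c + b * c)
    simp only [eval_mul, map_add]; ring
  zero_mul a := eval_ext fun y => by
    change eval y ((0 : HsAlg hσ) * a) = eval y 0
    simp only [eval_mul, map_zero, zero_mul]
  mul_zero a := eval_ext fun y => by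
    change eval y (a * (0 : HsAlg hσ)) = eval y 0
    simp only [eval_mul, map_zero, mul_zero]
  mul_assoc a b c := eval_ext fun y => by
    change eval y (a * b * c) = eval y (a * (b * c))
    simp only [eval_mul, mul_assoc]
  one_mul a := eval_ext fun y => by
    change eval y ((1 : HsAlg hσ) * a) = eval y a
    simp only [eval_mul, eval_one, one_mul]
  mul_one a := eval_ext fun y => by
    change eval y (a * (1 : HsAlg hσ)) = eval y a
    simp only [eval_mul, eval_one, mul_one]
  mul_comm a b := eval_ext fun y => by
    change eval y (a * b) = eval y (b * a)
    simp only [eval_mul, mul_comm]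
  norm_mul_le := norm_mul_le'

instance : Algebra ℂ (HsAlg hσ) :=
  Algebra.ofModule
    (fun r a b => eval_ext fun y => by simp only [eval_mul, map_smul, smul_eq_mul, mul_assoc])
    (fun r a b => eval_ext fun y => by
      simp only [eval_mul, map_smul, smul_eq_mul]; ring)

instance : NormedAlgebra ℂ (HsAlg hσ) where
  norm_smul_le r a := norm_smul_le r a

@[simp] lemma eval_sum {ι : Type*} (t : Finset ι) (f : ι → HsAlg hσ) (y : E6) :
    eval y (∑ i ∈ t, f i) = ∑ i ∈ t, eval y (f i) := map_sum _ _ _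

variable (hσ) in
/-- The element of `ℂ ⊕ H^σ` given by an element of `H^σ`. -/
def incl : Lp ℂ 2 (volume : Measure E6) →L[ℂ] HsAlg hσ :=
  (mulConst hσ : ℂ) • ((WithLp.prodContinuousLinearEquiv 1 ℂ ℂ
    (Lp ℂ 2 (volume : Measure E6))).symm.toContinuousLinearMap.comp
    (ContinuousLinearMap.inr ℂ ℂ (Lp ℂ 2 (volume : Measure E6))))

@[simp] lemma const_incl (g : Lp ℂ 2 (volume : Measure E6)) : const (incl hσ g) = 0 := by
  change (mulConst hσ : ℂ) * 0 = 0
  simp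

@[simp] lemma eval_incl (g : Lp ℂ 2 (volume : Measure E6)) (y : E6) :
    eval y (incl hσ g) = synth hσ g y := by
  have h : tail (incl hσ g) = (mulConst hσ : ℂ) • g := rfl
  rw [eval_apply, const_incl, h, map_smul, BoundedContinuousFunction.coe_smul, zero_add]
  exact inv_mul_cancel_left₀ (mulConst_ne_zero hσ) _

/-- The component in `H^σ`. -/
def proj : HsAlg hσ →L[ℂ] Lp ℂ 2 (volume : Measure E6) := (mulConst hσ : ℂ)⁻¹ • tail

lemma synth_proj (a : HsAlg hσ) (y : E6) : synth hσ (proj a) y = eval y a - const a := by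
  rw [eval_apply, add_sub_cancel_left]
  simp [proj]

lemma exists_eval_eq_schwartz (f : SchwartzMap E6 ℂ) : ∃ a : HsAlg hσ, ∀ y, eval y a = f y := by
  obtain ⟨g, hg⟩ := exists_synth_eq_schwartz hσ f
  exact ⟨incl hσ g, fun y => by rw [eval_incl, hg]⟩

lemma exists_eval_eq_smooth {f : E6 → ℂ} (hf : ContDiff ℝ ∞ f) (hc : HasCompactSupport f) :
    ∃ a : HsAlg hσ, ∀ y, eval y a = f y :=
  exists_eval_eq_schwartz (hc.toSchwartzMap hf)

/-- A character which takes the value `1` on some test function is the evaluation at some point, on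
the test functions. -/
lemma exists_character_eq_eval (φ : HsAlg hσ →ₐ[ℂ] ℂ) {θ : E6 → ℝ} (hθ : ContDiff ℝ ∞ θ)
    (hc : HasCompactSupport θ) {Θ : HsAlg hσ} (hΘ : ∀ y, eval y Θ = θ y) (h1 : φ Θ = 1) :
    ∃ y, θ y = 1 ∧ ∀ F : HsAlg hσ, ContDiff ℝ ∞ (fun y => eval y F) →
      HasCompactSupport (fun y => eval y F) → φ F = eval y F := by
  have hcθ : HasCompactSupport (fun y : E6 => (θ y : ℂ)) :=
    hc.comp_left (g := Complex.ofReal) Complex.ofReal_zero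
  have hθ' : ContDiff ℝ ∞ (fun y : E6 => (θ y : ℂ)) := Complex.ofRealCLM.contDiff.comp hθ
  -- If the test functions in the kernel of `φ` had no common zero, finitely many `F z` would have
  -- none on the compact support of `θ`. Then `H = ∑ |F z|²` lies in the kernel and is nonzero on
  -- that support, so `Θ = (θ/H)·H` lies in the kernel too, contradicting `φ Θ = 1`.
  have key : ∃ y, ∀ F : HsAlg hσ, ContDiff ℝ ∞ (fun y => eval y F) →
      HasCompactSupport (fun y => eval y F) → φ F = 0 → eval y F = 0 := by
    by_contra! hcon
    choose F hF hFc hF0 hFy using hcon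
    obtain ⟨t, ht⟩ := hc.isCompact.elim_finite_subcover (fun z => {y | eval y (F z) ≠ 0})
      (fun z => isOpen_ne_fun (continuous_eval _) continuous_const)
      (fun y _ => mem_iUnion.2 ⟨y, hFy y⟩)
    have hconj : ∀ z, ∃ G : HsAlg hσ, ∀ y, eval y G = (starRingEnd ℂ) (eval y (F z)) := fun z =>
      exists_eval_eq_smooth (Complex.conjCLE.contDiff.comp (hF z))
        ((hFc z).comp_left (g := starRingEnd ℂ) (map_zero _))
    choose G hG using hconj
    set H : HsAlg hσ := ∑ z ∈ t, G z * F z with hH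
    have hHev : ∀ y, eval y H = ((∑ z ∈ t, Complex.normSq (eval y (F z)) : ℝ) : ℂ) := by
      intro y
      rw [hH, eval_sum, Complex.ofReal_sum]
      refine Finset.sum_congr rfl fun z _ => ?_
      rw [eval_mul, hG, Complex.normSq_eq_conj_mul_self]
    have hHne : ∀ y ∈ tsupport θ, eval y H ≠ 0 := by
      intro y hy
      obtain ⟨z, hz, hzy⟩ := mem_iUnion₂.1 (ht hy)
      rw [hHev]
      have : 0 < ∑ z ∈ t, Complex.normSq (eval y (F z)) :=
        Finset.sum_pos' (fun z _ => Complex.normSq_nonneg _) ⟨z, hz, Complex.normSq_pos.2 hzy⟩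
      exact_mod_cast this.ne'
    have hHs : ContDiff ℝ ∞ (fun y => eval y H) := by
      have e : (fun y => eval y H)
          = fun y => ∑ z ∈ t, (starRingEnd ℂ) (eval y (F z)) * eval y (F z) := by
        ext y
        simp [hH, hG]
      rw [e]
      exact ContDiff.sum fun z _ => (Complex.conjCLE.contDiff.comp (hF z)).mul (hF z)
    have hq : ContDiff ℝ ∞ (fun y => (θ y : ℂ) * (eval y H)⁻¹) := by
      rw [contDiff_iff_contDiffAt]
      intro y
      by_cases hy : y ∈ tsupport θ
      · exact hθ'.contDiffAt.mul (hHs.contDiffAt.inv (hHne y hy))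
      · have : ∀ᶠ z in 𝓝 y, (θ z : ℂ) * (eval z H)⁻¹ = 0 := by
          filter_upwards [(isClosed_tsupport θ).isOpen_compl.mem_nhds hy] with z hz
          rw [image_eq_zero_of_notMem_tsupport hz]
          simp
        exact contDiffAt_const.congr_of_eventuallyEq this
    obtain ⟨Q, hQ⟩ := exists_eval_eq_smooth (hσ := hσ) hq (hcθ.mul_right)
    have hΘQ : Θ = Q * H := eval_ext fun y => by
      rw [hΘ, eval_mul, hQ]
      by_cases hy : y ∈ tsupport θ
      · rw [inv_mul_cancel_right₀ (hHne y hy)]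
      · simp [image_eq_zero_of_notMem_tsupport hy]
    rw [hΘQ, map_mul, hH, map_sum] at h1
    simp [hF0] at h1
  obtain ⟨y, hy⟩ := key
  -- The test function `F - φ(F)Θ` is in the kernel, so it vanishes at `y`.
  have hev : ∀ F : HsAlg hσ, ContDiff ℝ ∞ (fun y => eval y F) →
      HasCompactSupport (fun y => eval y F) → eval y F = φ F * θ y := by
    intro F hF hFc
    have h := hy (F - φ F • Θ) ?_ ?_ ?_
    · rw [map_sub, map_smul, hΘ, smul_eq_mul, sub_eq_zero] at h
      exact h
    · simp only [map_sub, map_smul, hΘ, smul_eq_mul]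
      exact hF.sub (contDiff_const.mul hθ')
    · simp only [map_sub, map_smul, hΘ, smul_eq_mul]
      exact hFc.sub (hcθ.mul_left)
    · rw [map_sub, map_smul, h1]
      simp
  -- If `θ y` were zero, every test function would vanish at `y`; a bump function equal to 1 there
  -- does not.
  have hne : (θ y : ℂ) ≠ 0 := by
    obtain ⟨b, hb, hbc, -, hb1, -⟩ := exists_smooth_cutoff (isCompact_singleton (x := y)) isOpen_univ
      (subset_univ _)
    have hbc' : HasCompactSupport (fun y : E6 => (b y : ℂ)) :=
      hbc.comp_left (g := Complex.ofReal) Complex.ofReal_zero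
    have hb' : ContDiff ℝ ∞ (fun y : E6 => (b y : ℂ)) := Complex.ofRealCLM.contDiff.comp hb
    obtain ⟨B, hB⟩ := exists_eval_eq_smooth (hσ := hσ) hb' hbc'
    have := hev B (by simpa only [hB] using hb') (by simpa only [hB] using hbc')
    rw [hB, hb1 y rfl] at this
    intro h0
    simp [h0] at this
  -- Applied to `Θ²`, the formula reads `θ(y)² = θ(y)`, which forces `θ(y) = 1`.
  have hsq := hev (Θ * Θ) (by simpa only [eval_mul, hΘ] using hθ'.mul hθ')
    (by simp only [eval_mul, hΘ]; exact hcθ.mul_right)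
  rw [eval_mul, hΘ, map_mul, h1, one_mul] at hsq
  have hθy : (θ y : ℂ) = 1 := mul_right_cancel₀ hne hsq
  refine ⟨y, by exact_mod_cast hθy, fun F hF hFc => ?_⟩
  rw [hev F hF hFc, hθy, mul_one]

/-- An element of `1 + H^σ` which does not vanish, and is `1` outside of a compact set, is
invertible. -/
lemma isUnit_of_ne_zero {a : HsAlg hσ} {K : Set E6} (hK : IsCompact K)
    (h1 : ∀ y ∉ K, eval y a = 1) (hne : ∀ y, eval y a ≠ 0) : IsUnit a := by
  by_contra hu
  -- Gelfand theory: a noninvertible element of a commutative complex Banach algebra is annihilated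
  -- by some character.
  obtain ⟨φ', hφ'⟩ := WeakDual.CharacterSpace.exists_apply_eq_zero hu
  set φ : HsAlg hσ →ₐ[ℂ] ℂ := WeakDual.CharacterSpace.toAlgHom φ' with hφ
  have hφc : Continuous φ := map_continuous φ'
  have hφa : φ a = 0 := hφ'
  obtain ⟨θ, hθ, hc, -, hθ1, -⟩ := exists_smooth_cutoff hK isOpen_univ (subset_univ _)
  have hcθ : HasCompactSupport (fun y : E6 => (θ y : ℂ)) :=
    hc.comp_left (g := Complex.ofReal) Complex.ofReal_zero
  have hθ' : ContDiff ℝ ∞ (fun y : E6 => (θ y : ℂ)) := Complex.ofRealCLM.contDiff.comp hθ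
  obtain ⟨Θ, hΘ⟩ := exists_eval_eq_smooth (hσ := hσ) hθ' hcθ
  -- Since `a - 1` vanishes off `K` and `θ = 1` on `K`. Together with `φ a = 0` this gives `φ Θ =
  -- 1`, so the character is not the one at infinity.
  have hmul : Θ * (a - 1) = a - 1 := eval_ext fun y => by
    rw [eval_mul, map_sub, eval_one, hΘ]
    by_cases hy : y ∈ K
    · rw [hθ1 y hy]; simp
    · rw [h1 y hy]; simp
  have hφΘ : φ Θ = 1 := by
    have := congrArg φ hmul
    rw [map_mul, map_sub, map_one, hφa] at this
    simpa using this
  obtain ⟨y, hy1, hy⟩ := exists_character_eq_eval φ hθ hc hΘ hφΘ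
  -- For a Schwartz function `f`, the product `Θf` is a test function, and `φ Θ = θ(y) = 1` removes
  -- the cut-off on both sides. Density and continuity extend the equality to all of `H^σ`.
  have hS : ∀ g : Lp ℂ 2 (volume : Measure E6), φ (incl hσ g) = eval y (incl hσ g) := by
    have hcl : IsClosed {g : Lp ℂ 2 (volume : Measure E6) |
        φ (incl hσ g) = eval y (incl hσ g)} :=
      isClosed_eq (hφc.comp (incl hσ).continuous) ((eval y).continuous.comp (incl hσ).continuous)
    have hd := dense_synth_schwartz hσ
    intro g
    refine hcl.closure_subset_iff.2 ?_ (hd g)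
    rintro g ⟨f, hf⟩
    have hev : (fun y => eval y (Θ * incl hσ g)) = fun y => (θ y : ℂ) * f y := by
      ext z
      rw [eval_mul, hΘ, eval_incl, hf]
    have h2 := hy (Θ * incl hσ g) (by rw [hev]; exact hθ'.mul (f.smooth ⊤))
      (by rw [hev]; exact hcθ.mul_right)
    rw [map_mul, hφΘ, one_mul, eval_mul, hΘ, hy1] at h2
    simpa using h2
  have hconst : const a = 1 := by
    refine tendsto_nhds_unique (tendsto_eval a) (tendsto_const_nhds.congr' ?_)
    filter_upwards [hK.compl_mem_cocompact] with y hy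
    exact (h1 y hy).symm
  have ha : a = 1 + incl hσ (proj a) := eval_ext fun z => by
    rw [map_add, eval_one, eval_incl, synth_proj, hconst]
    ring
  have : φ a = eval y a := by
    rw [ha, map_add, map_one, hS, map_add, eval_one]
  exact hne y (this.symm.trans hφa)

end HsAlg

/-! ### Families of functions which are locally of class `H^σ` -/

/-- The family `f_S` of functions on the open set `Ω`, with the parameter `S ∈ D`, is locally of
class `H^σ`, and depends continuously on `S` in the local `H^σ` topology. -/
def LocHs {X : Type*} [TopologicalSpace X] (Ω : Set E6) {σ : ℝ} (hσ : 3 < σ) (D : Set X)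
    (f : X → E6 → ℝ) : Prop :=
  ∀ χ : E6 → ℝ, ContDiff ℝ ∞ χ → HasCompactSupport χ → tsupport χ ⊆ Ω →
    ∃ G : X → HsAlg hσ, ContinuousOn G D ∧
      ∀ S ∈ D, ∀ y, HsAlg.eval y (G S) = ((χ y * f S y : ℝ) : ℂ)

namespace LocHs

variable {X : Type*} [TopologicalSpace X] {Ω : Set E6} {σ : ℝ} {hσ : 3 < σ} {D : Set X}
  {f f' : X → E6 → ℝ}

lemma hasCompactSupport_eval {χ f : E6 → ℝ} (hc : HasCompactSupport χ) {a : HsAlg hσ}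
    (h : ∀ y, HsAlg.eval y a = ((χ y * f y : ℝ) : ℂ)) :
    HasCompactSupport fun y => HsAlg.eval y a := by
  rw [show (fun y => HsAlg.eval y a) = fun y => ((χ y * f y : ℝ) : ℂ) from funext h]
  exact (HasCompactSupport.mul_right hc (f' := f)).comp_left (g := Complex.ofReal)
    Complex.ofReal_zero

lemma const_eq_zero {χ f : E6 → ℝ} (hc : HasCompactSupport χ) {a : HsAlg hσ}
    (h : ∀ y, HsAlg.eval y a = ((χ y * f y : ℝ) : ℂ)) : HsAlg.const a = 0 :=
  HsAlg.const_eq_zero_of_hasCompactSupport (hasCompactSupport_eval hc h)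

lemma synth_proj {χ f : E6 → ℝ} (hc : HasCompactSupport χ) {a : HsAlg hσ}
    (h : ∀ y, HsAlg.eval y a = ((χ y * f y : ℝ) : ℂ)) (y : E6) :
    synth hσ (HsAlg.proj a) y = ((χ y * f y : ℝ) : ℂ) := by
  rw [HsAlg.synth_proj, const_eq_zero hc h, sub_zero, h]

lemma congr (h : LocHs Ω hσ D f) (he : ∀ S ∈ D, ∀ y ∈ Ω, f S y = f' S y) :
    LocHs Ω hσ D f' := by
  intro χ h1 h2 h3
  obtain ⟨G, hG, hGe⟩ := h χ h1 h2 h3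
  refine ⟨G, hG, fun S hS y => ?_⟩
  rw [hGe S hS]
  by_cases hy : y ∈ tsupport χ
  · rw [he S hS y (h3 hy)]
  · simp [image_eq_zero_of_notMem_tsupport hy]

lemma add (h : LocHs Ω hσ D f) (h' : LocHs Ω hσ D f') :
    LocHs Ω hσ D (fun S y => f S y + f' S y) := by
  intro χ h1 h2 h3
  obtain ⟨G, hG, hGe⟩ := h χ h1 h2 h3
  obtain ⟨G', hG', hGe'⟩ := h' χ h1 h2 h3
  refine ⟨fun S => G S + G' S, hG.add hG', fun S hS y => ?_⟩
  rw [map_add, hGe S hS, hGe' S hS]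
  push_cast
  ring

/-- With a second cut-off `θ` equal to 1 on the support of `χ`, one has `χ f f' = (χ f)(θ f')`, a
product of two elements of the algebra. -/
lemma mul (h : LocHs Ω hσ D f) (h' : LocHs Ω hσ D f') (hΩ : IsOpen Ω) :
    LocHs Ω hσ D (fun S y => f S y * f' S y) := by
  intro χ h1 h2 h3
  obtain ⟨θ, hθ, hθc, hθΩ, hθ1, -⟩ := exists_smooth_cutoff h2.isCompact hΩ h3
  obtain ⟨G, hG, hGe⟩ := h χ h1 h2 h3
  obtain ⟨G', hG', hGe'⟩ := h' θ hθ hθc hθΩ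
  refine ⟨fun S => G S * G' S, hG.mul hG', fun S hS y => ?_⟩
  rw [HsAlg.eval_mul, hGe S hS, hGe' S hS, ← Complex.ofReal_mul]
  by_cases hy : y ∈ tsupport χ
  · rw [hθ1 y hy]
    congr 1
    ring
  · simp [image_eq_zero_of_notMem_tsupport hy]

lemma contDiff_mul_of_tsupport_subset {χ F : E6 → ℝ} (hχ : ContDiff ℝ ∞ χ) (hΩ : IsOpen Ω)
    (hs : tsupport χ ⊆ Ω) (hF : ContDiffOn ℝ ∞ F Ω) : ContDiff ℝ ∞ (fun y => χ y * F y) := by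
  rw [contDiff_iff_contDiffAt]
  intro y
  by_cases hy : y ∈ tsupport χ
  · exact hχ.contDiffAt.mul (hF.contDiffAt (hΩ.mem_nhds (hs hy)))
  · have : ∀ᶠ z in 𝓝 y, χ z * F z = 0 := by
      filter_upwards [(isClosed_tsupport χ).isOpen_compl.mem_nhds hy] with z hz
      rw [image_eq_zero_of_notMem_tsupport hz, zero_mul]
    exact contDiffAt_const.congr_of_eventuallyEq this

lemma of_contDiffOn (hΩ : IsOpen Ω) {F : E6 → ℝ} (hF : ContDiffOn ℝ ∞ F Ω) {c : X → ℝ}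
    (hc : ContinuousOn c D) : LocHs Ω hσ D (fun S y => c S * F y) := by
  intro χ h1 h2 h3
  have h4 := contDiff_mul_of_tsupport_subset h1 hΩ h3 hF
  have h5 : HasCompactSupport (fun y => ((χ y * F y : ℝ) : ℂ)) :=
    (HasCompactSupport.mul_right h2 (f' := F)).comp_left (g := Complex.ofReal)
      Complex.ofReal_zero
  obtain ⟨a, ha⟩ := HsAlg.exists_eval_eq_smooth (hσ := hσ)
    (Complex.ofRealCLM.contDiff.comp h4) h5
  refine ⟨fun S => (c S : ℂ) • a,
    (Complex.continuous_ofReal.comp_continuousOn hc).smul continuousOn_const, fun S hS y => ?_⟩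
  rw [map_smul, ha, smul_eq_mul]
  simp only [Function.comp_apply, Complex.ofRealCLM_apply]
  push_cast
  ring

lemma smooth (hΩ : IsOpen Ω) {F : E6 → ℝ} (hF : ContDiffOn ℝ ∞ F Ω) :
    LocHs Ω hσ D (fun _ y => F y) :=
  (of_contDiffOn hΩ hF (c := fun _ => 1) continuousOn_const).congr fun _ _ _ _ => one_mul _

lemma scalar (hΩ : IsOpen Ω) {c : X → ℝ} (hc : ContinuousOn c D) :
    LocHs Ω hσ D (fun S _ => c S) :=
  (of_contDiffOn hΩ contDiffOn_const hc (F := fun _ => 1)).congr fun _ _ _ _ => mul_one _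

lemma const_mul (h : LocHs Ω hσ D f) (hΩ : IsOpen Ω) (c : ℝ) :
    LocHs Ω hσ D (fun S y => c * f S y) :=
  (scalar hΩ continuousOn_const).mul h hΩ

lemma sub (h : LocHs Ω hσ D f) (h' : LocHs Ω hσ D f') (hΩ : IsOpen Ω) :
    LocHs Ω hσ D (fun S y => f S y - f' S y) :=
  (h.add (h'.const_mul hΩ (-1))).congr fun _ _ _ _ => by ring

lemma pow (h : LocHs Ω hσ D f) (hΩ : IsOpen Ω) (n : ℕ) :
    LocHs Ω hσ D (fun S y => f S y ^ n) := by
  induction n with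
  | zero => exact (smooth hΩ contDiffOn_const (F := fun _ => 1)).congr fun _ _ _ _ => by simp
  | succ n ih => exact (ih.mul h hΩ).congr fun _ _ _ _ => by rw [pow_succ]

lemma sum (hΩ : IsOpen Ω) {ι : Type*} (t : Finset ι) {F : ι → X → E6 → ℝ}
    (h : ∀ i ∈ t, LocHs Ω hσ D (F i)) : LocHs Ω hσ D (fun S y => ∑ i ∈ t, F i S y) := by
  classical
  induction t using Finset.induction_on with
  | empty => simpa using smooth (X := X) (hσ := hσ) (D := D) hΩ (contDiffOn_const (c := (0 : ℝ)))
  | insert a s ha ih =>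
    refine ((h a (Finset.mem_insert_self _ _)).add
      (ih fun i hi => h i (Finset.mem_insert_of_mem hi))).congr fun S _ y _ => ?_
    rw [Finset.sum_insert ha]

/-- The function `1 + θ(f - 1)` interpolates between `f` on the support of `χ` and 1 off a compact
set. Being a convex combination of positive numbers, it is positive, hence invertible in the
algebra. Multiplying its inverse by `χ` gives `χ/f`, and inversion is continuous at units. -/
lemma inv (h : LocHs Ω hσ D f) (hΩ : IsOpen Ω) (hpos : ∀ S ∈ D, ∀ y ∈ Ω, 0 < f S y) :
    LocHs Ω hσ D (fun S y => (f S y)⁻¹) := by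
  intro χ h1 h2 h3
  obtain ⟨θ, hθ, hθc, hθΩ, hθ1, hθ01⟩ := exists_smooth_cutoff h2.isCompact hΩ h3
  obtain ⟨G, hG, hGe⟩ := (h.sub (smooth hΩ (contDiffOn_const (c := (1 : ℝ)))) hΩ) θ hθ hθc hθΩ
  obtain ⟨C, -, hC⟩ := (smooth (X := X) (hσ := hσ) (D := D) hΩ
    (contDiffOn_const (c := (1 : ℝ)))) χ h1 h2 h3
  have hev : ∀ S ∈ D, ∀ y, HsAlg.eval y (1 + G S) = ((1 + θ y * (f S y - 1) : ℝ) : ℂ) := by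
    intro S hS y
    rw [map_add, HsAlg.eval_one, hGe S hS, Complex.ofReal_add, Complex.ofReal_one]
  have hgt : ∀ S ∈ D, ∀ y, 0 < 1 + θ y * (f S y - 1) := by
    intro S hS y
    by_cases hy : y ∈ tsupport θ
    · have h5 := hpos S hS y (hθΩ hy)
      obtain ⟨h6, h7⟩ := hθ01 y
      rcases h7.lt_or_eq with h7 | h7
      · nlinarith
      · rw [h7]; linarith
    · simp [image_eq_zero_of_notMem_tsupport hy]
  have hunit : ∀ S ∈ D, IsUnit (1 + G S) := by
    intro S hS
    refine HsAlg.isUnit_of_ne_zero hθc.isCompact (fun y hy => ?_) fun y => ?_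
    · rw [hev S hS]
      have : θ y = 0 := image_eq_zero_of_notMem_tsupport hy
      simp [this]
    · rw [hev S hS]
      exact_mod_cast (hgt S hS y).ne'
  have hinv : ContinuousOn (fun S => Ring.inverse (1 + G S)) D := by
    intro S hS
    obtain ⟨u, hu⟩ := hunit S hS
    have h8 := NormedRing.inverse_continuousAt u
    rw [hu] at h8
    exact h8.comp_continuousWithinAt (f := fun S => 1 + G S)
      (continuousWithinAt_const.add (hG S hS))
  refine ⟨fun S => C S * Ring.inverse (1 + G S), ?_, fun S hS y => ?_⟩
  · by_cases hne : D.Nonempty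
    · obtain ⟨S₀, hS₀⟩ := hne
      refine (continuousOn_const (c := C S₀).mul hinv).congr fun S hS => ?_
      -- For each `S ∈ D` the element `C S` has the values of `χ`, so it does not depend on `S`.
      have : C S = C S₀ := HsAlg.eval_ext fun y => by rw [hC S hS, hC S₀ hS₀]
      simp only [this, Pi.mul_apply]
    · rw [not_nonempty_iff_eq_empty.1 hne]
      exact continuousOn_empty _
  · have h9 := congrArg (HsAlg.eval y) (Ring.mul_inverse_cancel _ (hunit S hS))
    rw [HsAlg.eval_mul, HsAlg.eval_one, hev S hS] at h9
    rw [HsAlg.eval_mul, hC S hS, mul_one]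
    by_cases hy : y ∈ tsupport χ
    · rw [hθ1 y hy] at h9
      rw [eq_inv_of_mul_eq_one_right h9]
      push_cast
      congr 2
      ring
    · simp [image_eq_zero_of_notMem_tsupport hy]

lemma mono {τ : ℝ} {hτ : 3 < τ} (h : LocHs Ω hσ D f) (hle : τ ≤ σ) : LocHs Ω hτ D f := by
  intro χ h1 h2 h3
  obtain ⟨G, hG, hGe⟩ := h χ h1 h2 h3
  obtain ⟨I, hI⟩ := exists_synth_inclusion hτ hσ hle
  refine ⟨fun S => HsAlg.incl hτ (I (HsAlg.proj (G S))), ?_, fun S hS y => ?_⟩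
  · exact ((HsAlg.incl hτ).comp (I.comp HsAlg.proj)).continuous.comp_continuousOn hG
  · rw [HsAlg.eval_incl, hI, synth_proj h2 (hGe S hS)]

lemma contDiffOn (h : LocHs Ω hσ D f) (hΩ : IsOpen Ω) (n : ℕ) (hn : 3 + n < σ) {S : X}
    (hS : S ∈ D) : ContDiffOn ℝ n (f S) Ω := by
  intro y hy
  obtain ⟨K, hK, hyK, hKΩ⟩ := exists_compact_subset hΩ hy
  obtain ⟨θ, hθ, hθc, hθΩ, hθ1, -⟩ := exists_smooth_cutoff hK hΩ hKΩ
  obtain ⟨G, -, hGe⟩ := h θ hθ hθc hθΩ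
  have h1 := contDiff_synth n hσ hn (HsAlg.proj (G S))
  have h2 : ContDiff ℝ n (fun y => (synth hσ (HsAlg.proj (G S)) y).re) :=
    Complex.reCLM.contDiff.comp h1
  have h3 : ∀ᶠ z in 𝓝 y, f S z = (synth hσ (HsAlg.proj (G S)) z).re := by
    filter_upwards [mem_interior_iff_mem_nhds.1 hyK] with z hz
    rw [synth_proj hθc (hGe S hS), Complex.ofReal_re, hθ1 z hz, one_mul]
  exact (h2.contDiffAt.congr_of_eventuallyEq h3).contDiffWithinAt

/-- By the product rule `χ ∂_w f = ∂_w(χ f) - (∂_w χ) f`. The last term is again a localization of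
`f`, since `∂_w χ` is supported inside the support of `χ`. -/
lemma fderiv_apply {hσ' : 3 < σ - 1} (h : LocHs Ω hσ D f) (hΩ : IsOpen Ω) (w : E6) :
    LocHs Ω hσ' D (fun S y => fderiv ℝ (f S) y w) := by
  have hdiff : ∀ S ∈ D, ∀ y ∈ Ω, DifferentiableAt ℝ (f S) y := fun S hS y hy =>
    ((h.contDiffOn hΩ 1 (by norm_num; linarith) hS).contDiffAt
      (hΩ.mem_nhds hy)).differentiableAt (by norm_num)
  intro χ h1 h2 h3
  obtain ⟨I, hI⟩ := exists_synth_deriv hσ hσ' w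
  have hχ' : ContDiff ℝ ∞ (fun y => fderiv ℝ χ y w) :=
    (h1.fderiv_right (m := ∞) (by simp)).clm_apply contDiff_const
  have hsub : tsupport (fun y => fderiv ℝ χ y w) ⊆ tsupport χ := tsupport_fderiv_apply_subset ℝ w
  obtain ⟨G, hG, hGe⟩ := h χ h1 h2 h3
  obtain ⟨G', hG', hGe'⟩ := (h.mono (hτ := hσ') (by linarith)) _ hχ'
    (h2.of_isClosed_subset (isClosed_tsupport _) hsub) (hsub.trans h3)
  refine ⟨fun S => HsAlg.incl hσ' (I (HsAlg.proj (G S))) - G' S, ?_, fun S hS y => ?_⟩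
  · exact (((HsAlg.incl hσ').comp (I.comp HsAlg.proj)).continuous.comp_continuousOn hG).sub hG'
  · have e : (synth hσ (HsAlg.proj (G S)) : E6 → ℂ) = fun y => ((χ y * f S y : ℝ) : ℂ) :=
      funext (synth_proj h2 (hGe S hS))
    rw [map_sub, HsAlg.eval_incl, hI, e, hGe' S hS]
    by_cases hy : y ∈ tsupport χ
    · have hd : HasFDerivAt (fun y => χ y * f S y) (χ y • fderiv ℝ (f S) y + f S y • fderiv ℝ χ y)
          y := ((h1.differentiable (by simp)) y).hasFDerivAt.mul (hdiff S hS y (h3 hy)).hasFDerivAt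
      have hd2 := (Complex.ofRealCLM.hasFDerivAt (x := χ y * f S y)).comp y hd
      have e3 : fderiv ℝ (fun y => ((χ y * f S y : ℝ) : ℂ)) y = Complex.ofRealCLM.comp
          (χ y • fderiv ℝ (f S) y + f S y • fderiv ℝ χ y) := hd2.fderiv
      rw [e3]
      simp only [ContinuousLinearMap.comp_apply, Complex.ofRealCLM_apply, _root_.add_apply,
        _root_.smul_apply, smul_eq_mul]
      rw [← Complex.ofReal_sub]
      congr 1
      ring
    · have h0 : (fun y => ((χ y * f S y : ℝ) : ℂ)) =ᶠ[𝓝 y] fun _ => 0 := by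
        filter_upwards [(isClosed_tsupport χ).isOpen_compl.mem_nhds hy] with z hz
        rw [image_eq_zero_of_notMem_tsupport hz, zero_mul, Complex.ofReal_zero]
      have h0' : fderiv ℝ χ y w = 0 :=
        image_eq_zero_of_notMem_tsupport (f := fun y => fderiv ℝ χ y w) fun hh => hy (hsub hh)
      rw [h0.fderiv_eq, h0', image_eq_zero_of_notMem_tsupport hy]
      simp

end LocHs

/-! ### Change of frame -/

lemma sum_smul_stdVec (w : E6) : ∑ i, w i • stdVec i = w := by
  ext j
  simp [stdVec, Pi.single_apply]

@[simp] lemma stdVec_apply (i j : Fin 6) : stdVec i j = if j = i then 1 else 0 := by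
  simp [stdVec]

/-- The Gram matrix of a frame changes by congruence. -/
lemma gram_change_frame {V : Type*} [AddCommGroup V] [Module ℝ V] [TopologicalSpace V]
    (B : V →L[ℝ] V →L[ℝ] ℝ) (b b' : Fin 6 → V) (P : Matrix (Fin 6) (Fin 6) ℝ)
    (h : ∀ i, b' i = ∑ a, P a i • b a) :
    (Matrix.of fun i j => B (b' i) (b' j)) = P.transpose * (Matrix.of fun i j => B (b i) (b j)) * P := by
  ext i j
  simp only [Matrix.of_apply, h, map_sum, map_smul, Matrix.mul_apply, Matrix.transpose_apply,
    _root_.sum_apply, _root_.smul_apply, smul_eq_mul, Finset.mul_sum, Finset.sum_mul]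
  refine Finset.sum_congr rfl fun c _ => Finset.sum_congr rfl fun a _ => ?_
  ring

/-- This converts the inverse metric `g^{ij}` from the coordinate frame to the standard frame of the
tangent space. -/
lemma inv_eq_of_congruence {n : Type*} [Fintype n] [DecidableEq n] {G G' P Q : Matrix n n ℝ}
    (h : G' = P.transpose * G * P) (hPQ : P * Q = 1) : G⁻¹ = P * G'⁻¹ * P.transpose := by
  have hQ : P⁻¹ = Q := Matrix.inv_eq_right_inv hPQ
  have hT : P.transpose⁻¹ = Q.transpose := by rw [← Matrix.transpose_nonsing_inv, hQ]
  have hQP : Q.transpose * P.transpose = 1 := by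
    rw [← Matrix.transpose_mul, hPQ, Matrix.transpose_one]
  rw [h, Matrix.mul_inv_rev, Matrix.mul_inv_rev, hQ, hT]
  calc G⁻¹ = (P * Q) * G⁻¹ * (Q.transpose * P.transpose) := by rw [hPQ, hQP]; simp
    _ = _ := by simp only [Matrix.mul_assoc]

/-- The `p`-th tensor power of a matrix. -/
def matrixTensorPow {n : Type*} (p : ℕ) (A : Matrix n n ℝ) : Matrix (Fin p → n) (Fin p → n) ℝ :=
  Matrix.of fun i j => ∏ k, A (i k) (j k)

/-- A product of sums expands over all multi-indices. The contraction with `p` copies of `g^{ij}`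
thus becomes a single quadratic form that changes by congruence. -/
lemma matrixTensorPow_mul {n : Type*} [Fintype n] [DecidableEq n] (p : ℕ) (A B : Matrix n n ℝ) :
    matrixTensorPow p (A * B) = matrixTensorPow p A * matrixTensorPow p B := by
  ext i j
  simp only [matrixTensorPow, Matrix.of_apply, Matrix.mul_apply]
  rw [Finset.prod_univ_sum, Fintype.piFinset_univ]
  simp only [Finset.prod_mul_distrib]

lemma matrixTensorPow_transpose {n : Type*} (p : ℕ) (A : Matrix n n ℝ) :
    matrixTensorPow p A.transpose = (matrixTensorPow p A).transpose := rfl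

/-- The squared norm of an alternating form, in terms of a frame and of its Gram matrix. -/
def frameNormSq {V : Type*} [AddCommGroup V] [Module ℝ V] [TopologicalSpace V] {p : ℕ}
    (C : Matrix (Fin 6) (Fin 6) ℝ) (F : V [⋀^Fin p]→L[ℝ] ℝ) (b : Fin 6 → V) : ℝ :=
  ∑ i : Fin p → Fin 6, ∑ j : Fin p → Fin 6,
    (∏ k, C (i k) (j k)) * F (fun k => b (i k)) * F (fun k => b (j k))

/-- By multilinearity the components of `F` change by the transpose of the tensor power of `P`,
which can be moved onto the matrix of the quadratic form. -/
lemma frameNormSq_change_frame {V : Type*} [AddCommGroup V] [Module ℝ V] [TopologicalSpace V]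
    {p : ℕ} (C : Matrix (Fin 6) (Fin 6) ℝ) (F : V [⋀^Fin p]→L[ℝ] ℝ) (b b' : Fin 6 → V)
    (P : Matrix (Fin 6) (Fin 6) ℝ) (h : ∀ i, b' i = ∑ a, P a i • b a) :
    frameNormSq C F b' = frameNormSq (P * C * P.transpose) F b := by
  have hF : ∀ j : Fin p → Fin 6, F (fun k => b' (j k))
      = ((matrixTensorPow p P).transpose.mulVec fun i => F (fun k => b (i k))) j := by
    intro j
    have h1 := F.toMultilinearMap.map_sum (fun k a => P a (j k) • b a)
    have h2 : F (fun k => b' (j k)) = F.toMultilinearMap (fun k => ∑ a, P a (j k) • b a) := by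
      simp only [h]; rfl
    rw [h2, h1]
    simp only [Matrix.mulVec, dotProduct, Matrix.transpose_apply, matrixTensorPow, Matrix.of_apply]
    refine Finset.sum_congr rfl fun i _ => ?_
    exact F.toMultilinearMap.map_smul_univ (fun k => P (i k) (j k)) (fun k => b (i k))
  have hq : ∀ (C : Matrix (Fin 6) (Fin 6) ℝ) (W : (Fin p → Fin 6) → ℝ),
      ∑ i : Fin p → Fin 6, ∑ j : Fin p → Fin 6, (∏ k, C (i k) (j k)) * W i * W j
        = W ⬝ᵥ (matrixTensorPow p C).mulVec W := by
    intro C W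
    simp only [dotProduct, Matrix.mulVec, matrixTensorPow, Matrix.of_apply, Finset.mul_sum]
    refine Finset.sum_congr rfl fun i _ => Finset.sum_congr rfl fun j _ => ?_
    ring
  unfold frameNormSq
  simp only [hF]
  rw [hq, hq, matrixTensorPow_mul, matrixTensorPow_mul, matrixTensorPow_transpose,
    ← Matrix.mulVec_mulVec, ← Matrix.mulVec_mulVec, Matrix.dotProduct_mulVec _ (matrixTensorPow p P),
    ← Matrix.mulVec_transpose]

/-- The gradient of a linear form, in terms of a frame and of the inverse `C` of its Gram matrix. -/
def frameGrad {V : Type*} [AddCommGroup V] [Module ℝ V] [TopologicalSpace V]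
    (C : Matrix (Fin 6) (Fin 6) ℝ) (d : V →L[ℝ] ℝ) (b : Fin 6 → V) : V :=
  ∑ i, ∑ j, (C i j * d (b j)) • b i

lemma frameGrad_eq {V : Type*} [AddCommGroup V] [Module ℝ V] [TopologicalSpace V]
    (C : Matrix (Fin 6) (Fin 6) ℝ) (d : V →L[ℝ] ℝ) (b : Fin 6 → V) :
    frameGrad C d b = ∑ i, (C.mulVec (fun j => d (b j)) i) • b i := by
  simp only [frameGrad, Matrix.mulVec, dotProduct, Finset.sum_smul]

lemma frameGrad_change_frame {V : Type*} [AddCommGroup V] [Module ℝ V] [TopologicalSpace V]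
    (C : Matrix (Fin 6) (Fin 6) ℝ) (d : V →L[ℝ] ℝ) (b b' : Fin 6 → V)
    (P : Matrix (Fin 6) (Fin 6) ℝ) (h : ∀ i, b' i = ∑ a, P a i • b a) :
    frameGrad C d b' = frameGrad (P * C * P.transpose) d b := by
  have h1 : (fun j => d (b' j)) = P.transpose.mulVec fun a => d (b a) := by
    ext j
    simp [h, Matrix.mulVec, dotProduct]
  rw [frameGrad_eq, frameGrad_eq, h1, ← Matrix.mulVec_mulVec, ← Matrix.mulVec_mulVec]
  generalize C.mulVec (P.transpose.mulVec fun a => d (b a)) = c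
  simp only [h, Finset.smul_sum, smul_smul]
  rw [Finset.sum_comm]
  refine Finset.sum_congr rfl fun a _ => ?_
  rw [← Finset.sum_smul]
  simp only [Matrix.mulVec, dotProduct, mul_comm]

/-- A vector `c` in the kernel of the Gram matrix gives a combination `∑ cᵢbᵢ` of square zero,
against positivity. -/
lemma det_gram_ne_zero {V : Type*} [AddCommGroup V] [Module ℝ V] [TopologicalSpace V]
    (B : V →L[ℝ] V →L[ℝ] ℝ) (hB : ∀ v, v ≠ 0 → 0 < B v v) (b : Fin 6 → V)
    (hb : ∀ c : Fin 6 → ℝ, ∑ i, c i • b i = 0 → c = 0) :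
    (Matrix.of fun i j => B (b i) (b j)).det ≠ 0 := by
  intro h0
  obtain ⟨c, hc, h⟩ := Matrix.exists_mulVec_eq_zero_iff.2 h0
  have h1 := hB (∑ i, c i • b i) fun hX => hc (hb c hX)
  have h2 : B (∑ i, c i • b i) (∑ i, c i • b i)
      = c ⬝ᵥ (Matrix.of fun i j => B (b i) (b j)).mulVec c := by
    simp only [map_sum, map_smul, _root_.sum_apply, _root_.smul_apply, smul_eq_mul,
      dotProduct, Matrix.mulVec, Matrix.of_apply, Finset.mul_sum]
    rw [Finset.sum_comm]
    refine Finset.sum_congr rfl fun i _ => Finset.sum_congr rfl fun j _ => ?_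
    ring
  rw [h2, h, dotProduct_zero] at h1
  exact lt_irrefl _ h1

lemma inner_frameGrad {V : Type*} [AddCommGroup V] [Module ℝ V] [TopologicalSpace V]
    (B : V →L[ℝ] V →L[ℝ] ℝ) (hB : ∀ v w, B v w = B w v) (b : Fin 6 → V)
    (hdet : (Matrix.of fun i j => B (b i) (b j)).det ≠ 0) (d : V →L[ℝ] ℝ) (c : Fin 6 → ℝ) :
    B (frameGrad (Matrix.of fun i j => B (b i) (b j))⁻¹ d b) (∑ i, c i • b i)
      = d (∑ i, c i • b i) := by
  have h3 : ∀ k, B (frameGrad (Matrix.of fun i j => B (b i) (b j))⁻¹ d b) (b k) = d (b k) := by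
    intro k
    set G : Matrix (Fin 6) (Fin 6) ℝ := Matrix.of fun i j => B (b i) (b j) with hG
    have h4 : G.mulVec (G⁻¹.mulVec fun j => d (b j)) k = d (b k) := by
      rw [Matrix.mulVec_mulVec, Matrix.mul_nonsing_inv _ hdet.isUnit, Matrix.one_mulVec]
    rw [← h4, frameGrad_eq]
    generalize G⁻¹.mulVec (fun j => d (b j)) = a
    simp only [map_sum, map_smul, _root_.sum_apply, _root_.smul_apply, smul_eq_mul,
      Matrix.mulVec, dotProduct]
    refine Finset.sum_congr rfl fun i _ => ?_
    rw [mul_comm, hB]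
    rfl
  simp only [map_sum, map_smul, h3]

/-! ### Charts -/

section Manifold

variable {M : Type*} [TopologicalSpace M] [ChartedSpace E6 M]

lemma mdifferentiable_of_mem_maximalAtlas {e : OpenPartialHomeomorph M E6}
    (he : e ∈ IsManifold.maximalAtlas (𝓡 6) ∞ M) : e.MDifferentiable (𝓡 6) (𝓡 6) :=
  ⟨(contMDiffOn_of_mem_maximalAtlas he).mdifferentiableOn (by simp),
    (contMDiffOn_symm_of_mem_maximalAtlas he).mdifferentiableOn (by simp)⟩

/-- The coordinates of a tangent vector in a chart. -/
def chartCov (e : OpenPartialHomeomorph M E6) (y : E6) : TangentSpace (𝓡 6) (e.symm y) →L[ℝ] E6 :=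
  mfderiv (𝓡 6) (𝓡 6) e (e.symm y)

lemma chartVec_sum (e : OpenPartialHomeomorph M E6) (y w : E6) :
    chartVec e y w = ∑ i, w i • chartVec e y (stdVec i) := by
  conv_lhs => rw [← sum_smul_stdVec w]
  unfold chartVec
  exact (map_sum (mfderiv (𝓡 6) (𝓡 6) e.symm y) _ _).trans
    (Finset.sum_congr rfl fun i _ => map_smul (mfderiv (𝓡 6) (𝓡 6) e.symm y) _ _)

lemma chartCov_chartVec {e : OpenPartialHomeomorph M E6}
    (he : e ∈ IsManifold.maximalAtlas (𝓡 6) ∞ M) {y : E6} (hy : y ∈ e.target) (w : E6) :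
    chartCov e y (chartVec e y w) = w :=
  congrArg (fun L => L w) ((mdifferentiable_of_mem_maximalAtlas he).comp_symm_deriv hy)

lemma chartVec_chartCov {e : OpenPartialHomeomorph M E6}
    (he : e ∈ IsManifold.maximalAtlas (𝓡 6) ∞ M) {y : E6} (hy : y ∈ e.target)
    (X : TangentSpace (𝓡 6) (e.symm y)) : chartVec e y (chartCov e y X) = X := by
  have h := (mdifferentiable_of_mem_maximalAtlas he).symm_comp_deriv (e.map_target hy)
  rw [e.right_inv hy] at h
  exact congrArg (fun L => L X) h

/-- The standard frame of `T_xM`. -/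
def stdTan (x : M) (i : Fin 6) : TangentSpace (𝓡 6) x := stdVec i

/-- The coordinates of a tangent vector in the standard frame. -/
def tanCoord (x : M) : TangentSpace (𝓡 6) x →L[ℝ] E6 := ContinuousLinearMap.id ℝ E6

lemma sum_tanCoord_smul (x : M) (X : TangentSpace (𝓡 6) x) :
    ∑ a, tanCoord x X a • stdTan x a = X := sum_smul_stdVec X

@[simp] lemma tanCoord_stdTan (x : M) (i : Fin 6) : tanCoord x (stdTan x i) = stdVec i := rfl

lemma tanCoord_sum (x : M) (c : Fin 6 → ℝ) (j : Fin 6) :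
    tanCoord x (∑ i, c i • stdTan x i) j = c j := by
  simp only [map_sum, map_smul, tanCoord_stdTan]
  simp

/-- The matrix of the coordinate frame with respect to the standard frame. -/
def frameMatrix (e : OpenPartialHomeomorph M E6) (y : E6) : Matrix (Fin 6) (Fin 6) ℝ :=
  Matrix.of fun a i => tanCoord _ (chartVec e y (stdVec i)) a

lemma chartVec_stdVec (e : OpenPartialHomeomorph M E6) (y : E6) (i : Fin 6) :
    chartVec e y (stdVec i) = ∑ a, frameMatrix e y a i • stdTan (e.symm y) a :=
  (sum_tanCoord_smul _ _).symm

lemma exists_frameMatrix_mul_eq_one {e : OpenPartialHomeomorph M E6}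
    (he : e ∈ IsManifold.maximalAtlas (𝓡 6) ∞ M) {y : E6} (hy : y ∈ e.target) :
    ∃ Q, frameMatrix e y * Q = 1 := by
  -- The columns of the inverse are the chart coordinates of the standard frame.
  refine ⟨Matrix.of fun i a => chartCov e y (stdTan (e.symm y) a) i, ?_⟩
  ext c a
  have h := chartVec_chartCov he hy (stdTan (e.symm y) a)
  rw [chartVec_sum] at h
  have h2 := congrArg (fun w => tanCoord _ w c) h
  simp only [map_sum, map_smul, tanCoord_stdTan, stdVec_apply] at h2
  rw [Matrix.mul_apply, Matrix.one_apply, ← h2]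
  simp [frameMatrix, mul_comm]

lemma dReal_chartVec {f : M → ℝ} {e : OpenPartialHomeomorph M E6}
    (he : e ∈ IsManifold.maximalAtlas (𝓡 6) ∞ M) {y : E6} (hy : y ∈ e.target)
    (hf : MDifferentiableAt (𝓡 6) 𝓘(ℝ, ℝ) f (e.symm y)) (w : E6) :
    dReal f (e.symm y) (chartVec e y w) = fderiv ℝ (fun z => f (e.symm z)) y w := by
  have h := mfderiv_comp y hf ((mdifferentiable_of_mem_maximalAtlas he).mdifferentiableAt_symm hy)
  rw [mfderiv_eq_fderiv] at h
  exact (congrArg (fun L => L w) h).symm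

variable [IsManifold (𝓡 6) ∞ M]

lemma chartGram_eq (g : SmoothMetric M) (e : OpenPartialHomeomorph M E6) (y : E6) :
    chartGram g e y = (frameMatrix e y).transpose * gramAt g (e.symm y) * frameMatrix e y :=
  gram_change_frame (g.inner (e.symm y)) _ _ _ (chartVec_stdVec e y)

lemma gramAt_inv_eq (g : SmoothMetric M) {e : OpenPartialHomeomorph M E6}
    (he : e ∈ IsManifold.maximalAtlas (𝓡 6) ∞ M) {y : E6} (hy : y ∈ e.target) :
    (gramAt g (e.symm y))⁻¹
      = frameMatrix e y * (chartGram g e y)⁻¹ * (frameMatrix e y).transpose := by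
  obtain ⟨Q, hQ⟩ := exists_frameMatrix_mul_eq_one he hy
  exact inv_eq_of_congruence (chartGram_eq g e y) hQ

lemma det_gramAt_ne_zero (g : SmoothMetric M) (x : M) : (gramAt g x).det ≠ 0 := by
  refine det_gram_ne_zero (g.inner x) (g.pos x) (stdTan x) fun c hc => funext fun j => ?_
  rw [← tanCoord_sum x c j, hc, map_zero]
  rfl

lemma det_chartGram_ne_zero (g : SmoothMetric M) {e : OpenPartialHomeomorph M E6}
    (he : e ∈ IsManifold.maximalAtlas (𝓡 6) ∞ M) {y : E6} (hy : y ∈ e.target) :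
    (chartGram g e y).det ≠ 0 := by
  obtain ⟨Q, hQ⟩ := exists_frameMatrix_mul_eq_one he hy
  have hP : (frameMatrix e y).det ≠ 0 := by
    intro h0
    have := congrArg Matrix.det hQ
    simp [h0] at this
  rw [chartGram_eq, Matrix.det_mul, Matrix.det_mul, Matrix.det_transpose]
  exact mul_ne_zero (mul_ne_zero hP (det_gramAt_ne_zero g _)) hP

/-! ### The gradient and the norm of forms in a chart -/

lemma formNormSq_chart (g : SmoothMetric M) {p : ℕ} (F : DiffForm M p)
    {e : OpenPartialHomeomorph M E6} (he : e ∈ IsManifold.maximalAtlas (𝓡 6) ∞ M) {y : E6}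
    (hy : y ∈ e.target) :
    formNormSq g F (e.symm y) = (1 / (p.factorial : ℝ)) *
      ∑ i : Fin p → Fin 6, ∑ j : Fin p → Fin 6, (∏ k, (chartGram g e y)⁻¹ (i k) (j k)) *
        F.comp e (fun k => stdVec (i k)) y * F.comp e (fun k => stdVec (j k)) y := by
  have h := frameNormSq_change_frame (chartGram g e y)⁻¹ (F (e.symm y)) _ _ _ (chartVec_stdVec e y)
  rw [← gramAt_inv_eq g he hy] at h
  have e1 : formNormSq g F (e.symm y) = (1 / (p.factorial : ℝ)) *
      frameNormSq (gramAt g (e.symm y))⁻¹ (F (e.symm y)) (stdTan (e.symm y)) := rfl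
  rw [e1, ← h]
  rfl

lemma grad_chart (g : SmoothMetric M) (f : M → ℝ) {e : OpenPartialHomeomorph M E6}
    (he : e ∈ IsManifold.maximalAtlas (𝓡 6) ∞ M) {y : E6} (hy : y ∈ e.target) :
    grad g f (e.symm y) = ∑ i, ∑ j, ((chartGram g e y)⁻¹ i j *
      dReal f (e.symm y) (chartVec e y (stdVec j))) • chartVec e y (stdVec i) := by
  have h := frameGrad_change_frame (chartGram g e y)⁻¹ (dReal f (e.symm y)) _ _ _
    (chartVec_stdVec e y)
  rw [← gramAt_inv_eq g he hy] at h
  exact h.symm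

lemma inner_grad (g : SmoothMetric M) (f : M → ℝ) (x : M) (X : TangentSpace (𝓡 6) x) :
    g.inner x (grad g f x) X = dReal f x X := by
  have h := inner_frameGrad (g.inner x) (g.symm x) (stdTan x) (det_gramAt_ne_zero g x)
    (dReal f x) (tanCoord x X)
  rw [sum_tanCoord_smul] at h
  exact h

lemma chartCoord_grad (g : SmoothMetric M) {f : M → ℝ} {e : OpenPartialHomeomorph M E6}
    (he : e ∈ IsManifold.maximalAtlas (𝓡 6) ∞ M) {y : E6} (hy : y ∈ e.target)
    (hf : MDifferentiableAt (𝓡 6) 𝓘(ℝ, ℝ) f (e.symm y)) (i : Fin 6) :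
    chartCoord e (grad g f) i y = ∑ j, (chartGram g e y)⁻¹ i j *
      fderiv ℝ (fun z => f (e.symm z)) y (stdVec j) := by
  change chartCov e y (grad g f (e.symm y)) i = _
  rw [grad_chart g f he hy]
  simp only [map_sum, map_smul, chartCov_chartVec he hy, dReal_chartVec he hy hf]
  simp

lemma inner_grad_grad_chart (g : SmoothMetric M) {f : M → ℝ} {e : OpenPartialHomeomorph M E6}
    (he : e ∈ IsManifold.maximalAtlas (𝓡 6) ∞ M) {y : E6} (hy : y ∈ e.target)
    (hf : MDifferentiableAt (𝓡 6) 𝓘(ℝ, ℝ) f (e.symm y)) :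
    g.inner (e.symm y) (grad g f (e.symm y)) (grad g f (e.symm y))
      = ∑ i, ∑ j, (chartGram g e y)⁻¹ i j * fderiv ℝ (fun z => f (e.symm z)) y (stdVec j) *
        fderiv ℝ (fun z => f (e.symm z)) y (stdVec i) := by
  rw [inner_grad, grad_chart g f he hy]
  simp only [map_sum, map_smul, dReal_chartVec he hy hf, smul_eq_mul]

/-! ### Smoothness of the metric in a chart -/

/-- The coordinate field is the tangent map of `e⁻¹` applied to a constant field on `ℝ⁶`. -/
lemma contMDiffOn_chartVec {e : OpenPartialHomeomorph M E6}
    (he : e ∈ IsManifold.maximalAtlas (𝓡 6) ∞ M) (w : E6) :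
    ContMDiffOn (𝓡 6) (𝓡 6).tangent ∞
      (fun y => (⟨e.symm y, chartVec e y w⟩ : TangentBundle (𝓡 6) M)) e.target := by
  have h1 := (contMDiffOn_symm_of_mem_maximalAtlas he).contMDiffOn_tangentMapWithin (m := ∞)
    (by simp) e.open_target.uniqueMDiffOn
  have h2 : ContMDiff (𝓡 6) (𝓡 6).tangent ∞ (fun y : E6 => (⟨y, w⟩ : TangentBundle (𝓡 6) E6)) :=
    contMDiff_vectorSpace_iff_contDiff.2 contDiff_const
  have h3 := h1.comp (s := e.target) h2.contMDiffOn fun y hy => hy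
  refine h3.congr fun y hy => ?_
  simp only [Function.comp_apply, tangentMapWithin, chartVec]
  rw [mfderivWithin_of_isOpen e.open_target hy]

lemma contDiffOn_chartGram (g : SmoothMetric M) {e : OpenPartialHomeomorph M E6}
    (he : e ∈ IsManifold.maximalAtlas (𝓡 6) ∞ M) (i j : Fin 6) :
    ContDiffOn ℝ ∞ (fun y => chartGram g e y i j) e.target := by
  intro y hy
  have hb : ContMDiffWithinAt (𝓡 6) (𝓡 6) ∞ e.symm e.target y :=
    contMDiffOn_symm_of_mem_maximalAtlas he y hy
  have : ContMDiffWithinAt (𝓡 6) ((𝓡 6).prod 𝓘(ℝ)) ∞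
      (fun m => Bundle.TotalSpace.mk' ℝ (E := Bundle.Trivial M ℝ) (e.symm m)
        (g.inner (e.symm m) (chartVec e m (stdVec i)) (chartVec e m (stdVec j)))) e.target y := by
    apply ContMDiffWithinAt.clm_bundle_apply₂ (F₁ := E6) (F₂ := E6)
    · exact ContMDiffAt.comp_contMDiffWithinAt y g.contMDiff.contMDiffAt hb
    · exact contMDiffOn_chartVec he (stdVec i) y hy
    · exact contMDiffOn_chartVec he (stdVec j) y hy
  simp only [Bundle.contMDiffWithinAt_totalSpace] at this
  exact this.2.contDiffWithinAt

/-- Cramer's rule: the adjugate is polynomial in the entries and the determinant does not vanish. -/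
lemma contDiffOn_chartGram_inv (g : SmoothMetric M) {e : OpenPartialHomeomorph M E6}
    (he : e ∈ IsManifold.maximalAtlas (𝓡 6) ∞ M) (i j : Fin 6) :
    ContDiffOn ℝ ∞ (fun y => (chartGram g e y)⁻¹ i j) e.target := by
  have hdet : ∀ A : E6 → Matrix (Fin 6) (Fin 6) ℝ,
      (∀ i j, ContDiffOn ℝ ∞ (fun y => A y i j) e.target) →
      ContDiffOn ℝ ∞ (fun y => (A y).det) e.target := by
    intro A hA
    simp only [Matrix.det_apply']
    exact ContDiffOn.sum fun σ _ => contDiffOn_const.mul (contDiffOn_prod fun k _ => hA _ _)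
  have hG := contDiffOn_chartGram g he
  have hadj : ContDiffOn ℝ ∞ (fun y => (chartGram g e y).adjugate i j) e.target := by
    simp only [Matrix.adjugate_apply]
    refine hdet _ fun a b => ?_
    by_cases hab : a = j
    · subst hab
      simp only [Matrix.updateRow_self]
      exact contDiffOn_const
    · simp only [Matrix.updateRow_ne hab]
      exact hG a b
  refine (((hdet _ hG).inv fun y hy => det_chartGram_ne_zero g he hy).mul hadj).congr
    fun y hy => ?_
  rw [Matrix.inv_def, Matrix.smul_apply, Ring.inverse_eq_inv', smul_eq_mul]
  rfl

end Manifold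

/-! ### The divergence does not depend on the chart -/

lemma sum_mul_eq_trace {n : Type*} [Fintype n] {C D : Matrix n n ℝ} (hC : C.transpose = C) :
    ∑ i, ∑ j, C i j * D i j = (C * D).trace := by
  rw [Matrix.trace, Finset.sum_comm]
  simp only [Matrix.diag_apply, Matrix.mul_apply]
  rw [Finset.sum_comm]
  conv_rhs => rw [Finset.sum_comm]
  refine Finset.sum_congr rfl fun i _ => Finset.sum_congr rfl fun j _ => ?_
  rw [← congrFun (congrFun hC i) j, Matrix.transpose_apply]

/-- The logarithmic derivative of the determinant of a Gram matrix under a change of frame. -/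
lemma trace_inv_mul_congruence {n : Type*} [Fintype n] [DecidableEq n] {G G' J A E D' : Matrix n n ℝ}
    (hG : G.det ≠ 0) (hJ : J.det ≠ 0) (hsymm : G.transpose = G)
    (hG' : G' = J.transpose * G * J)
    (hD' : D' = A.transpose * G * J + J.transpose * E * J + J.transpose * G * A) :
    ∑ i, ∑ j, G'⁻¹ i j * D' i j = ∑ i, ∑ j, G⁻¹ i j * E i j + 2 * (J⁻¹ * A).trace := by
  have hsymm' : G'.transpose = G' := by
    rw [hG', Matrix.transpose_mul, Matrix.transpose_mul, Matrix.transpose_transpose, hsymm,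
      Matrix.mul_assoc]
  have hi : ∀ S : Matrix n n ℝ, S.transpose = S → (S⁻¹).transpose = S⁻¹ := fun S hS => by
    rw [Matrix.transpose_nonsing_inv, hS]
  rw [sum_mul_eq_trace (hi _ hsymm'), sum_mul_eq_trace (hi _ hsymm)]
  have hJT : IsUnit J.transpose.det := by rw [Matrix.det_transpose]; exact hJ.isUnit
  have e1 : G'⁻¹ = J⁻¹ * G⁻¹ * J.transpose⁻¹ := by
    rw [hG', Matrix.mul_inv_rev, Matrix.mul_inv_rev, Matrix.mul_assoc]
  -- In `D'`, the derivative of `JᵀGJ`, the two terms containing the derivative `A` of `J`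
  -- contribute `tr(J⁻¹A)` each; the middle term contributes the trace for `G`.
  have t1 : (G'⁻¹ * (A.transpose * G * J)).trace = (J⁻¹ * A).trace := by
    rw [e1, Matrix.trace_mul_comm]
    have : A.transpose * G * J * (J⁻¹ * G⁻¹ * J.transpose⁻¹) = A.transpose * J.transpose⁻¹ := by
      calc _ = A.transpose * (G * (J * J⁻¹) * G⁻¹) * J.transpose⁻¹ := by
            simp only [Matrix.mul_assoc]
        _ = _ := by
            rw [Matrix.mul_nonsing_inv _ hJ.isUnit, Matrix.mul_one,
              Matrix.mul_nonsing_inv _ hG.isUnit, Matrix.mul_one]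
    rw [this, ← Matrix.transpose_nonsing_inv, ← Matrix.transpose_mul, Matrix.trace_transpose]
  have t2 : (G'⁻¹ * (J.transpose * E * J)).trace = (G⁻¹ * E).trace := by
    rw [e1, Matrix.trace_mul_comm]
    have : J.transpose * E * J * (J⁻¹ * G⁻¹ * J.transpose⁻¹)
        = J.transpose * (E * G⁻¹ * J.transpose⁻¹) := by
      calc _ = J.transpose * (E * ((J * J⁻¹) * G⁻¹) * J.transpose⁻¹) := by
            simp only [Matrix.mul_assoc]
        _ = _ := by
            rw [Matrix.mul_nonsing_inv _ hJ.isUnit, Matrix.one_mul]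
    rw [this, Matrix.trace_mul_comm, Matrix.mul_assoc, Matrix.nonsing_inv_mul _ hJT, Matrix.mul_one,
      Matrix.trace_mul_comm]
  have t3 : (G'⁻¹ * (J.transpose * G * A)).trace = (J⁻¹ * A).trace := by
    have : J⁻¹ * G⁻¹ * J.transpose⁻¹ * (J.transpose * G * A) = J⁻¹ * A := by
      calc _ = J⁻¹ * (G⁻¹ * (J.transpose⁻¹ * J.transpose) * G) * A := by
            simp only [Matrix.mul_assoc]
        _ = _ := by
            rw [Matrix.nonsing_inv_mul _ hJT, Matrix.mul_one,
              Matrix.nonsing_inv_mul _ hG.isUnit, Matrix.mul_one]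
    rw [e1, this]
  rw [hD', Matrix.mul_add, Matrix.mul_add, Matrix.trace_add, Matrix.trace_add, t1, t2, t3]
  ring

/-- The matrix of partial derivatives of `Φ`. -/
def jacobianMatrix (Φ : E6 → E6) (z : E6) : Matrix (Fin 6) (Fin 6) ℝ :=
  Matrix.of fun a i => fderiv ℝ Φ z (stdVec i) a

/-- The divergence of a vector field with components `X^i` for the metric `G`. -/
def coordDiv (G : E6 → Matrix (Fin 6) (Fin 6) ℝ) (X : Fin 6 → E6 → ℝ) (y : E6) : ℝ :=
  (∑ i, fderiv ℝ (X i) y (stdVec i)) +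
    ∑ k, (1 / 2 * ∑ i, ∑ j, (G y)⁻¹ i j * fderiv ℝ (fun z => G z i j) y (stdVec k)) * X k y

lemma fderiv_apply_eq_sum (L : E6 →L[ℝ] ℝ) (w : E6) : L w = ∑ m, w m * L (stdVec m) := by
  conv_lhs => rw [← sum_smul_stdVec w]
  simp

lemma hasFDerivAt_jacobianMatrix {Φ : E6 → E6} {y : E6} (hΦ : ContDiffAt ℝ ∞ Φ y) (a i : Fin 6) :
    HasFDerivAt (fun z => jacobianMatrix Φ z a i)
      ((EuclideanSpace.proj (𝕜 := ℝ) a).comp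
        ((ContinuousLinearMap.apply ℝ E6 (stdVec i)).comp (fderiv ℝ (fderiv ℝ Φ) y))) y := by
  have h1 : HasFDerivAt (fderiv ℝ Φ) (fderiv ℝ (fderiv ℝ Φ) y) y :=
    ((hΦ.fderiv_right (m := 1) (by norm_cast)).differentiableAt (by norm_num)).hasFDerivAt
  exact (EuclideanSpace.proj (𝕜 := ℝ) a).hasFDerivAt.comp y
    ((ContinuousLinearMap.apply ℝ E6 (stdVec i)).hasFDerivAt.comp y h1)

/-- Symmetry of second derivatives; the cancellation in `coordDiv_change_coordinates` depends on it.
-/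
lemma fderiv_jacobianMatrix_symm {Φ : E6 → E6} {y : E6} (hΦ : ContDiffAt ℝ ∞ Φ y)
    (a i k : Fin 6) : fderiv ℝ (fun z => jacobianMatrix Φ z a i) y (stdVec k)
      = fderiv ℝ (fun z => jacobianMatrix Φ z a k) y (stdVec i) := by
  have h : IsSymmSndFDerivAt ℝ Φ y :=
    hΦ.isSymmSndFDerivAt (by
      rw [minSmoothness_of_isRCLikeNormedField]
      exact WithTop.coe_le_coe.2 (le_top : (2 : ℕ∞) ≤ ⊤))
  rw [(hasFDerivAt_jacobianMatrix hΦ a i).fderiv, (hasFDerivAt_jacobianMatrix hΦ a k).fderiv]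
  exact congrArg (fun w : E6 => w a) (h (stdVec k) (stdVec i))

/-- Here `t` stands for the traces `tr(J⁻¹A_k)`. They arise on one side from differentiating the
field and on the other from the logarithmic derivative of the metric determinant, where the factor 2
meets the `1/2`. -/
lemma sum_change_coordinates {n : Type*} [Fintype n] (J : Matrix n n ℝ) (x t c : n → ℝ) (d : ℝ) :
    ∑ i, x i * t i + d + ∑ m, (1 / 2 * c m) * ∑ k, J m k * x k
      = d + ∑ k, (1 / 2 * (∑ m, J m k * c m + 2 * t k)) * x k := by
  have h : ∑ m, (1 / 2 * c m) * ∑ k, J m k * x k = ∑ k, (1 / 2 * ∑ m, J m k * c m) * x k := by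
    simp only [Finset.mul_sum, Finset.sum_mul]
    rw [Finset.sum_comm]
    refine Finset.sum_congr rfl fun k _ => Finset.sum_congr rfl fun m _ => ?_
    ring
  rw [h, add_comm (∑ i, x i * t i), add_assoc, ← Finset.sum_add_distrib]
  congr 1
  refine Finset.sum_congr rfl fun k _ => ?_
  ring

/-- The coordinate expression of the divergence is invariant under changes of coordinates. -/
lemma coordDiv_change_coordinates {Φ : E6 → E6} {y' : E6} (hΦ : ContDiffAt ℝ ∞ Φ y')
    {G G' : E6 → Matrix (Fin 6) (Fin 6) ℝ} {X X' : Fin 6 → E6 → ℝ}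
    (hJ : (jacobianMatrix Φ y').det ≠ 0) (hGdet : (G (Φ y')).det ≠ 0)
    (hsymm : (G (Φ y')).transpose = G (Φ y'))
    (hGd : ∀ i j, DifferentiableAt ℝ (fun z => G z i j) (Φ y'))
    (hXd : ∀ i, DifferentiableAt ℝ (X i) (Φ y')) (hXd' : ∀ i, DifferentiableAt ℝ (X' i) y')
    (hG : ∀ᶠ z in 𝓝 y', G' z = (jacobianMatrix Φ z).transpose * G (Φ z) * jacobianMatrix Φ z)
    (hX : ∀ᶠ z in 𝓝 y', ∀ a, X a (Φ z) = ∑ i, jacobianMatrix Φ z a i * X' i z) :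
    coordDiv G X (Φ y') = coordDiv G' X' y' := by
  set J := jacobianMatrix Φ y' with hJdef
  have hΦd : HasFDerivAt Φ (fderiv ℝ Φ y') y' := (hΦ.differentiableAt (by simp)).hasFDerivAt
  have hJd := fun a i => (hasFDerivAt_jacobianMatrix hΦ a i).differentiableAt.hasFDerivAt
  set A : Fin 6 → Matrix (Fin 6) (Fin 6) ℝ := fun k =>
    Matrix.of fun a i => fderiv ℝ (fun z => jacobianMatrix Φ z a i) y' (stdVec k) with hA
  set E : Fin 6 → Matrix (Fin 6) (Fin 6) ℝ := fun m =>
    Matrix.of fun i j => fderiv ℝ (fun z => G z i j) (Φ y') (stdVec m) with hE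
  have hJcol : ∀ (L : E6 →L[ℝ] ℝ) (k : Fin 6),
      L (fderiv ℝ Φ y' (stdVec k)) = ∑ m, J m k * L (stdVec m) := fun L k =>
    fderiv_apply_eq_sum L _
  -- the derivatives of the metric
  have hGc : ∀ a b, HasFDerivAt (fun z => G (Φ z) a b)
      ((fderiv ℝ (fun z => G z a b) (Φ y')).comp (fderiv ℝ Φ y')) y' := fun a b =>
    (hGd a b).hasFDerivAt.comp y' hΦd
  have hD : ∀ k, (Matrix.of fun i j => fderiv ℝ (fun z => G' z i j) y' (stdVec k))
      = (A k).transpose * G (Φ y') * J + J.transpose * (∑ m, J m k • E m) * J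
        + J.transpose * G (Φ y') * A k := by
    intro k
    ext i j
    have h1 : (fun z => G' z i j) =ᶠ[𝓝 y'] fun z => ∑ b, (∑ a, jacobianMatrix Φ z a i *
        G (Φ z) a b) * jacobianMatrix Φ z b j := by
      filter_upwards [hG] with z hz
      rw [hz]
      simp only [Matrix.mul_apply, Matrix.transpose_apply]
    have h2 := HasFDerivAt.fun_sum (u := Finset.univ) fun b _ =>
      (HasFDerivAt.fun_sum (u := Finset.univ) fun a _ => (hJd a i).fun_mul (hGc a b)).fun_mul (hJd b j)
    rw [Matrix.of_apply, h1.fderiv_eq, h2.fderiv]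
    simp only [_root_.sum_apply, _root_.add_apply, _root_.smul_apply, smul_eq_mul,
      ContinuousLinearMap.comp_apply, hJcol, Matrix.add_apply, Matrix.mul_apply,
      Matrix.transpose_apply, Matrix.sum_apply, Matrix.smul_apply, hA, hE, Matrix.of_apply]
    rw [← Finset.sum_add_distrib, ← Finset.sum_add_distrib]
    refine Finset.sum_congr rfl fun b _ => ?_
    rw [Finset.sum_add_distrib, mul_add, Finset.mul_sum, Finset.mul_sum, Finset.sum_mul,
      Finset.sum_mul, Finset.sum_mul]
    have e1 : ∀ p q r s t u : ℝ, p = s → q = t → r = u → p + (q + r) = u + t + s := by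
      rintro p q r s t u rfl rfl rfl
      ring
    refine e1 _ _ _ _ _ _ rfl ?_ ?_
    · refine Finset.sum_congr rfl fun a _ => ?_
      ring
    · refine Finset.sum_congr rfl fun a _ => ?_
      rw [show J b j = jacobianMatrix Φ y' b j from rfl]
      ring
  have hG0 := hG.self_of_nhds
  have htr : ∀ k, ∑ i, ∑ j, (G' y')⁻¹ i j * fderiv ℝ (fun z => G' z i j) y' (stdVec k)
      = ∑ m, J m k * (∑ i, ∑ j, (G (Φ y'))⁻¹ i j * E m i j) + 2 * (J⁻¹ * A k).trace := by
    intro k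
    have h1 := trace_inv_mul_congruence hGdet hJ hsymm hG0 (hD k)
    simp only [Matrix.of_apply] at h1
    rw [h1]
    congr 1
    simp only [Matrix.sum_apply, Matrix.smul_apply, smul_eq_mul, Finset.mul_sum]
    rw [Finset.sum_congr rfl fun i _ => Finset.sum_comm, Finset.sum_comm]
    refine Finset.sum_congr rfl fun m _ => Finset.sum_congr rfl fun i _ =>
      Finset.sum_congr rfl fun j _ => ?_
    ring
  -- the derivatives of the field
  have hX0 := hX.self_of_nhds
  set DX : Matrix (Fin 6) (Fin 6) ℝ := Matrix.of fun a m => fderiv ℝ (X a) (Φ y') (stdVec m) with hDX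
  set DX' : Matrix (Fin 6) (Fin 6) ℝ := Matrix.of fun i k => fderiv ℝ (X' i) y' (stdVec k) with hDX'
  -- The relation `X ∘ Φ = J X'` differentiated by the chain and product rules. The symmetry of
  -- second derivatives lets `∂_k J_{ai}` be written as `∂_i J_{ak}`.
  have hDXJ : DX * J = ∑ i, X' i y' • A i + J * DX' := by
    ext a k
    have h1 : (fun z => X a (Φ z)) =ᶠ[𝓝 y'] fun z => ∑ i, jacobianMatrix Φ z a i * X' i z := by
      filter_upwards [hX] with z hz
      exact hz a
    have h2 := HasFDerivAt.fun_sum (u := Finset.univ) fun i _ => (hJd a i).fun_mul (hXd' i).hasFDerivAt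
    have h3 : HasFDerivAt (fun z => X a (Φ z)) _ y' := (hXd a).hasFDerivAt.comp y' hΦd
    have h4 := h1.fderiv_eq (𝕜 := ℝ)
    rw [h2.fderiv, h3.fderiv] at h4
    have h5 := congrArg (fun L : E6 →L[ℝ] ℝ => L (stdVec k)) h4
    simp only [ContinuousLinearMap.comp_apply, hJcol, _root_.sum_apply, _root_.add_apply,
      _root_.smul_apply, smul_eq_mul] at h5
    simp only [Matrix.mul_apply, Matrix.add_apply, Matrix.sum_apply, Matrix.smul_apply, hDX, hDX',
      Matrix.of_apply, smul_eq_mul, hA]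
    rw [Finset.sum_congr rfl fun m _ => mul_comm _ (J m k), h5, Finset.sum_add_distrib, add_comm]
    congr 1
    refine Finset.sum_congr rfl fun i _ => ?_
    rw [fderiv_jacobianMatrix_symm hΦ]
  have hdiv : DX.trace = ∑ i, X' i y' * (J⁻¹ * A i).trace + DX'.trace := by
    have h1 : DX = (∑ i, X' i y' • A i + J * DX') * J⁻¹ := by
      rw [← hDXJ, Matrix.mul_assoc, Matrix.mul_nonsing_inv _ hJ.isUnit, Matrix.mul_one]
    rw [h1, Matrix.trace_mul_comm, Matrix.mul_add, Matrix.trace_add, ← Matrix.mul_assoc,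
      Matrix.nonsing_inv_mul _ hJ.isUnit, Matrix.one_mul, Matrix.mul_sum, Matrix.trace_sum]
    simp only [Matrix.mul_smul, Matrix.trace_smul, smul_eq_mul]
  have e1 : ∑ i, fderiv ℝ (X i) (Φ y') (stdVec i) = DX.trace := rfl
  have e2 : ∑ i, fderiv ℝ (X' i) y' (stdVec i) = DX'.trace := rfl
  have e3 : ∀ k, ∑ i, ∑ j, (G (Φ y'))⁻¹ i j * fderiv ℝ (fun z => G z i j) (Φ y') (stdVec k)
    = ∑ i, ∑ j, (G (Φ y'))⁻¹ i j * E k i j := fun k => rfl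
  unfold coordDiv
  rw [e1, e2, hdiv]
  simp only [e3, htr, hX0]
  exact sum_change_coordinates J (fun k => X' k y') (fun k => (J⁻¹ * A k).trace)
    (fun m => ∑ i, ∑ j, (G (Φ y'))⁻¹ i j * E m i j) _

section Manifold

lemma eventually_mem_chart_inter {M : Type*} [TopologicalSpace M] (e e' : OpenPartialHomeomorph M E6) {z : E6} (hz : z ∈ e'.target)
    (hz' : e'.symm z ∈ e.source) : ∀ᶠ y in 𝓝 z, y ∈ e'.target ∧ e'.symm y ∈ e.source :=
  Filter.Eventually.and (e'.open_target.mem_nhds hz)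
    ((e'.continuousAt_symm hz).eventually (e.open_source.mem_nhds hz'))

variable {M : Type*} [TopologicalSpace M] [ChartedSpace E6 M]

lemma contDiffAt_chart_change {e e' : OpenPartialHomeomorph M E6}
    (he : e ∈ IsManifold.maximalAtlas (𝓡 6) ∞ M) (he' : e' ∈ IsManifold.maximalAtlas (𝓡 6) ∞ M)
    {z : E6} (hz : z ∈ e'.target) (hz' : e'.symm z ∈ e.source) :
    ContDiffAt ℝ ∞ (fun y => e (e'.symm y)) z := by
  have h1 := (contMDiffOn_of_mem_maximalAtlas he).contMDiffAt (e.open_source.mem_nhds hz')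
  have h2 := (contMDiffOn_symm_of_mem_maximalAtlas he').contMDiffAt (e'.open_target.mem_nhds hz)
  exact (h1.comp z h2).contDiffAt

lemma chartVec_chart_change {e e' : OpenPartialHomeomorph M E6}
    (he : e ∈ IsManifold.maximalAtlas (𝓡 6) ∞ M) (he' : e' ∈ IsManifold.maximalAtlas (𝓡 6) ∞ M)
    {z : E6} (hz : z ∈ e'.target) (hz' : e'.symm z ∈ e.source) (w : E6) :
    (show E6 from chartVec e' z w) =
      (show E6 from chartVec e (e (e'.symm z)) (fderiv ℝ (fun y => e (e'.symm y)) z w)) := by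
  have h1 : (e'.symm : E6 → M) =ᶠ[𝓝 z] e.symm ∘ fun y => e (e'.symm y) := by
    filter_upwards [eventually_mem_chart_inter e e' hz hz'] with y hy
    exact (e.left_inv hy.2).symm
  have h2 := (contDiffAt_chart_change he he' hz hz').differentiableAt (by simp)
  have h3 := mfderiv_comp z ((mdifferentiable_of_mem_maximalAtlas he).mdifferentiableAt_symm
    (e.map_source hz')) h2.mdifferentiableAt
  rw [mfderiv_eq_fderiv] at h3
  exact congrArg (fun L : E6 →L[ℝ] E6 => L w) (h1.mfderiv_eq.trans h3)

lemma chartCoord_chart_change {e e' : OpenPartialHomeomorph M E6}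
    (he : e ∈ IsManifold.maximalAtlas (𝓡 6) ∞ M) (he' : e' ∈ IsManifold.maximalAtlas (𝓡 6) ∞ M)
    {z : E6} (hz : z ∈ e'.target) (hz' : e'.symm z ∈ e.source)
    (X : (x : M) → TangentSpace (𝓡 6) x) (a : Fin 6) :
    chartCoord e X a (e (e'.symm z)) =
      ∑ i, jacobianMatrix (fun y => e (e'.symm y)) z a i * chartCoord e' X i z := by
  -- The base point `e⁻¹(e(e'⁻¹(z)))` is equal to `e'⁻¹(z)` but not by definition; a variable point
  -- `p` allows the tangent spaces to be identified by substitution.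
  have h0 : ∀ p : M, p = e'.symm z → (show E6 from mfderiv (𝓡 6) (𝓡 6) e p (X p)) a =
      (fderiv ℝ (fun y => e (e'.symm y)) z (mfderiv (𝓡 6) (𝓡 6) e' (e'.symm z) (X (e'.symm z)))) a := by
    rintro p rfl
    have h1 : (e : M → E6) =ᶠ[𝓝 (e'.symm z)] (fun y => e (e'.symm y)) ∘ e' := by
      filter_upwards [e'.open_source.mem_nhds (e'.map_target hz)] with p hp
      simp only [Function.comp_apply, e'.left_inv hp]
    have h2 := (contDiffAt_chart_change he he' hz hz').differentiableAt (by simp)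
    rw [← e'.right_inv hz] at h2
    have h3 := mfderiv_comp (e'.symm z) h2.mdifferentiableAt
      ((mdifferentiable_of_mem_maximalAtlas he').mdifferentiableAt (e'.map_target hz))
    rw [mfderiv_eq_fderiv, e'.right_inv hz] at h3
    exact congrArg (fun L : E6 →L[ℝ] E6 => L (X (e'.symm z)) a) (h1.mfderiv_eq.trans h3)
  refine (h0 _ (e.left_inv hz')).trans ?_
  have h4 := fderiv_apply_eq_sum ((EuclideanSpace.proj (𝕜 := ℝ) a).comp
    (fderiv ℝ (fun y => e (e'.symm y)) z)) (mfderiv (𝓡 6) (𝓡 6) e' (e'.symm z) (X (e'.symm z)))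
  exact h4.trans (Finset.sum_congr rfl fun i _ => mul_comm _ _)

variable [IsManifold (𝓡 6) ∞ M]

lemma chartGram_chart_change (g : SmoothMetric M) {e e' : OpenPartialHomeomorph M E6}
    (he : e ∈ IsManifold.maximalAtlas (𝓡 6) ∞ M) (he' : e' ∈ IsManifold.maximalAtlas (𝓡 6) ∞ M)
    {z : E6} (hz : z ∈ e'.target) (hz' : e'.symm z ∈ e.source) :
    chartGram g e' z = (jacobianMatrix (fun y => e (e'.symm y)) z).transpose *
      chartGram g e (e (e'.symm z)) * jacobianMatrix (fun y => e (e'.symm y)) z := by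
  have h0 : ∀ p q : M, p = q → ∀ v w v' w' : E6, v = v' → w = w' →
      g.inner p (show TangentSpace (𝓡 6) p from v) (show TangentSpace (𝓡 6) p from w) =
      g.inner q (show TangentSpace (𝓡 6) q from v') (show TangentSpace (𝓡 6) q from w') := by
    rintro p q rfl v w v' w' rfl rfl
    rfl
  refine Eq.trans ?_ (gram_change_frame (g.inner (e.symm (e (e'.symm z)))) _ _
    (jacobianMatrix (fun y => e (e'.symm y)) z) fun i => chartVec_sum e _ _)
  ext i j
  exact h0 _ _ (e.left_inv hz').symm _ _ _ _ (chartVec_chart_change he he' hz hz' _)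
    (chartVec_chart_change he he' hz hz' _)

/-- For differentiable fields, the divergence does not depend on the chart. -/
lemma chartDiv_congr_chart (g : SmoothMetric M) {e e' : OpenPartialHomeomorph M E6}
    (he : e ∈ IsManifold.maximalAtlas (𝓡 6) ∞ M) (he' : e' ∈ IsManifold.maximalAtlas (𝓡 6) ∞ M)
    {X : (x : M) → TangentSpace (𝓡 6) x} {z : E6} (hz : z ∈ e'.target)
    (hz' : e'.symm z ∈ e.source)
    (hXd : ∀ i, DifferentiableAt ℝ (chartCoord e X i) (e (e'.symm z)))
    (hXd' : ∀ i, DifferentiableAt ℝ (chartCoord e' X i) z) :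
    chartDiv g e X (e (e'.symm z)) = chartDiv g e' X z := by
  have hy : e (e'.symm z) ∈ e.target := e.map_source hz'
  refine coordDiv_change_coordinates (contDiffAt_chart_change he he' hz hz') (fun h0 => ?_)
    (det_chartGram_ne_zero g he hy) ?_ (fun i j => ?_) hXd hXd' ?_ ?_
  · have h := det_chartGram_ne_zero g he' hz
    rw [chartGram_chart_change g he he' hz hz', Matrix.det_mul, h0, mul_zero] at h
    exact h rfl
  · ext i j
    exact g.symm _ _ _
  · exact ((contDiffOn_chartGram g he i j).contDiffAt (e.open_target.mem_nhds hy)).differentiableAt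
      (by simp)
  · filter_upwards [eventually_mem_chart_inter e e' hz hz'] with y hy
    exact chartGram_chart_change g he he' hy.1 hy.2
  · filter_upwards [eventually_mem_chart_inter e e' hz hz'] with y hy
    exact chartCoord_chart_change he he' hy.1 hy.2 X

/-- The preferred chart in `diverg` jumps from point to point. Regularity becomes visible only in a
fixed chart, and the passage to it needs differentiability of the components in every chart. -/
lemma diverg_chart (g : SmoothMetric M) {X : (x : M) → TangentSpace (𝓡 6) x}
    (hX : ∀ e ∈ IsManifold.maximalAtlas (𝓡 6) ∞ M, ∀ y ∈ e.target, ∀ i,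
      DifferentiableAt ℝ (chartCoord e X i) y)
    {e : OpenPartialHomeomorph M E6} (he : e ∈ IsManifold.maximalAtlas (𝓡 6) ∞ M) {y : E6}
    (hy : y ∈ e.target) : diverg g X (e.symm y) = chartDiv g e X y := by
  have h := IsManifold.chart_mem_maximalAtlas (I := 𝓡 6) (n := ∞) (e.symm y)
  have hs := mem_chart_source E6 (e.symm y)
  exact chartDiv_congr_chart g h he hy hs
    (fun i => hX _ h _ ((chartAt E6 (e.symm y)).map_source hs) i) fun i => hX e he y hy i

end Manifold

/-! ### Families of functions of class `H^σ` on the manifold -/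

section Manifold

variable {M : Type*} [TopologicalSpace M] [ChartedSpace E6 M]

/-- The family `a_S` of functions on `M`, with the parameter `S ∈ D`, is of class `H^σ` and depends
continuously on `S`. -/
def HsFamily {X : Type*} [TopologicalSpace X] {σ : ℝ} (hσ : 3 < σ) (D : Set X)
    (a : X → M → ℝ) : Prop :=
  ∀ e ∈ IsManifold.maximalAtlas (𝓡 6) ∞ M, LocHs e.target hσ D fun S y => a S (e.symm y)

variable {X : Type*} [TopologicalSpace X] {σ : ℝ} {hσ : 3 < σ} {D : Set X}

lemma continuous_mul_of_tsupport_subset {χ f : E6 → ℝ} {Ω : Set E6} (hχ : Continuous χ)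
    (hΩ : IsOpen Ω) (hs : tsupport χ ⊆ Ω) (hf : ContinuousOn f Ω) :
    Continuous fun y => χ y * f y :=
  (hχ.continuousOn.mul hf).continuous_of_tsupport_subset hΩ
    ((closure_mono (Function.support_mul_subset_left _ _)).trans hs)

lemma Localizer.continuous_loc (l : Localizer M) {f : M → ℝ} (hf : Continuous f) :
    Continuous (l.loc f) :=
  continuous_mul_of_tsupport_subset l.smooth.continuous l.chart.open_target l.support
    (hf.comp_continuousOn l.chart.continuousOn_symm)

lemma Localizer.hasCompactSupport_loc (l : Localizer M) (f : M → ℝ) : HasCompactSupport (l.loc f) :=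
  HasCompactSupport.mul_right l.compact

/-- The localization of a function of class `H^σ`, as an element of `H^σ(ℝ⁶)`. -/
def HsFunction.locLp (l : Localizer M) (f : HsFunction M σ) : Lp ℂ 2 (volume : Measure E6) :=
  (f.memHs l).toLp (besselFourier σ (l.loc f))

lemma HsFunction.continuous_locLp (l : Localizer M) :
    Continuous (HsFunction.locLp l : HsFunction M σ → _) :=
  continuous_iInf_dom continuous_induced_dom

lemma HsFunction.synth_locLp (hσ : 3 < σ) (l : Localizer M) (f : HsFunction M σ) (y : E6) :
    synth hσ (f.locLp l) y = (l.loc f y : ℂ) :=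
  synth_besselFourier hσ (l.continuous_loc f.continuous_toFun) (l.hasCompactSupport_loc f) _ y

/-- The localized component of a form of class `H^σ`, as an element of `H^σ(ℝ⁶)`. -/
def HsForm.locLp {p : ℕ} (l : Localizer M) (w : Fin p → E6) (F : HsForm M p σ) :
    Lp ℂ 2 (volume : Measure E6) :=
  (F.memHs l w).toLp (besselFourier σ (l.locForm w F.toForm))

lemma HsForm.continuous_locLp {p : ℕ} (l : Localizer M) (w : Fin p → E6) :
    Continuous (HsForm.locLp l w : HsForm M p σ → _) :=
  continuous_iInf_dom (i := l) (continuous_iInf_dom (i := w) continuous_induced_dom)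

lemma HsForm.synth_locLp (hσ : 3 < σ) {p : ℕ} (l : Localizer M) (w : Fin p → E6) (F : HsForm M p σ)
    (y : E6) : synth hσ (F.locLp l w) y = (l.locForm w F.toForm y : ℂ) :=
  synth_besselFourier hσ (continuous_mul_of_tsupport_subset l.smooth.continuous
    l.chart.open_target l.support (F.continuousOn_comp _ l.chart_mem w))
    (HasCompactSupport.mul_right l.compact) _ y

lemma HsForm.locHs_comp (hσ : 3 < σ) {p : ℕ} {F : X → HsForm M p σ} (hF : ContinuousOn F D)
    {e : OpenPartialHomeomorph M E6} (he : e ∈ IsManifold.maximalAtlas (𝓡 6) ∞ M)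
    (w : Fin p → E6) : LocHs e.target hσ D fun S y => (F S).toForm.comp e w y := by
  intro χ h1 h2 h3
  let l : Localizer M := ⟨e, he, χ, h1, h2, h3⟩
  exact ⟨fun S => HsAlg.incl hσ ((F S).locLp l w), (HsAlg.incl hσ).continuous.comp_continuousOn
    ((HsForm.continuous_locLp l w).comp_continuousOn hF), fun S _ y =>
    (HsAlg.eval_incl _ y).trans (HsForm.synth_locLp hσ l w (F S) y)⟩

namespace HsFamily

variable {a a' : X → M → ℝ}

lemma of_continuousOn (hσ : 3 < σ) {V : X → HsFunction M σ} (hV : ContinuousOn V D) :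
    HsFamily hσ D fun S => V S := by
  intro e he χ h1 h2 h3
  let l : Localizer M := ⟨e, he, χ, h1, h2, h3⟩
  exact ⟨fun S => HsAlg.incl hσ ((V S).locLp l), (HsAlg.incl hσ).continuous.comp_continuousOn
    ((HsFunction.continuous_locLp l).comp_continuousOn hV), fun S _ y =>
    (HsAlg.eval_incl _ y).trans (HsFunction.synth_locLp hσ l (V S) y)⟩

lemma add (h : HsFamily hσ D a) (h' : HsFamily hσ D a') :
    HsFamily hσ D fun S x => a S x + a' S x :=
  fun e he => (h e he).add (h' e he)

lemma sub (h : HsFamily hσ D a) (h' : HsFamily hσ D a') :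
    HsFamily hσ D fun S x => a S x - a' S x :=
  fun e he => (h e he).sub (h' e he) e.open_target

lemma mul (h : HsFamily hσ D a) (h' : HsFamily hσ D a') :
    HsFamily hσ D fun S x => a S x * a' S x :=
  fun e he => (h e he).mul (h' e he) e.open_target

lemma pow (h : HsFamily hσ D a) (n : ℕ) : HsFamily hσ D fun S x => a S x ^ n :=
  fun e he => (h e he).pow e.open_target n

lemma const_mul (h : HsFamily hσ D a) (c : ℝ) : HsFamily hσ D fun S x => c * a S x :=
  fun e he => (h e he).const_mul e.open_target c

lemma scalar {c : X → ℝ} (hc : ContinuousOn c D) :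
    HsFamily hσ D fun S (_ : M) => c S :=
  fun e _ => LocHs.scalar e.open_target hc

lemma inv (h : HsFamily hσ D a) (hpos : ∀ S ∈ D, ∀ x, 0 < a S x) :
    HsFamily hσ D fun S x => (a S x)⁻¹ :=
  fun e he => (h e he).inv e.open_target fun S hS _ _ => hpos S hS _

lemma mono {τ : ℝ} {hτ : 3 < τ} (h : HsFamily hσ D a) (hle : τ ≤ σ) : HsFamily hτ D a :=
  fun e he => (h e he).mono hle

variable [IsManifold (𝓡 6) ∞ M]

lemma contMDiff (h : HsFamily hσ D a) (n : ℕ) (hn : 3 + n < σ) {S : X} (hS : S ∈ D) :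
    ContMDiff (𝓡 6) 𝓘(ℝ, ℝ) n (a S) := by
  intro x
  have he := IsManifold.chart_mem_maximalAtlas (I := 𝓡 6) (n := ∞) x
  set e := chartAt E6 x
  have hx : x ∈ e.source := mem_chart_source E6 x
  have h1 : ContMDiffAt (𝓡 6) 𝓘(ℝ, ℝ) n (fun y => a S (e.symm y)) (e x) :=
    (((h e he).contDiffOn e.open_target n hn hS).contDiffAt
      (e.open_target.mem_nhds (e.map_source hx))).contMDiffAt
  have h2 : ContMDiffAt (𝓡 6) (𝓡 6) n e x :=
    ((contMDiffOn_of_mem_maximalAtlas he).contMDiffAt (e.open_source.mem_nhds hx)).of_le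
      (by exact_mod_cast le_top)
  refine (h1.comp x h2).congr_of_eventuallyEq ?_
  filter_upwards [e.open_source.mem_nhds hx] with z hz
  simp only [Function.comp_apply, e.left_inv hz]

/-- The topology of `H^σ(M)` is the initial one for the localizations, and each of these is the
projection of a continuous family in the algebra. Off `D` the value is the irrelevant default 1. -/
lemma exists_hsFunction (h : HsFamily hσ D a) :
    ∃ A : X → HsFunction M σ, ContinuousOn A D ∧ ∀ S ∈ D, ∀ x, A S x = a S x := by
  classical
  have hm : ∀ S ∈ D, ∀ l : Localizer M, MemHsEuclidean σ (l.loc (a S)) := by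
    intro S hS l
    obtain ⟨G, -, hG⟩ := h l.chart l.chart_mem l.cutoff l.smooth l.compact l.support
    exact memHsEuclidean_of_synth hσ (l.hasCompactSupport_loc _)
      (LocHs.synth_proj l.compact (hG S hS))
  refine ⟨fun S => if hS : S ∈ D then
    ⟨a S, (h.contMDiff 0 (by simpa using hσ) hS).continuous, hm S hS⟩ else 1, ?_, ?_⟩
  · rw [continuousOn_iff_continuous_domRestrict]
    refine continuous_iInf_rng.2 fun l => continuous_induced_rng.2 ?_
    obtain ⟨G, hGc, hG⟩ := h l.chart l.chart_mem l.cutoff l.smooth l.compact l.support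
    refine (HsAlg.proj.continuous.comp (continuousOn_iff_continuous_domRestrict.1 hGc)).congr
      fun S => ?_
    refine (toLp_besselFourier_of_synth hσ (l.hasCompactSupport_loc _) (fun y => ?_)
      (HsFunction.memHs _ l)).symm
    simp only [domRestrict_apply, dif_pos S.2]
    exact LocHs.synth_proj l.compact (hG S S.2) y
  · intro S hS x
    simp only [dif_pos hS]

/-! ### The geometric operators -/

lemma formNormSq (g : SmoothMetric M) {p : ℕ} {F : X → HsForm M p σ} (hF : ContinuousOn F D) :
    HsFamily hσ D fun S x => formNormSq g (F S).toForm x := by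
  intro e he
  have hΩ := e.open_target
  have h1 : ∀ i j : Fin p → Fin 6, LocHs e.target hσ D fun S y =>
      (∏ k, (chartGram g e y)⁻¹ (i k) (j k)) * (F S).toForm.comp e (fun k => stdVec (i k)) y *
        (F S).toForm.comp e (fun k => stdVec (j k)) y := fun i j =>
    ((LocHs.smooth hΩ (contDiffOn_prod fun k _ => contDiffOn_chartGram_inv g he (i k) (j k))).mul
      (HsForm.locHs_comp hσ hF he fun k => stdVec (i k)) hΩ).mul
      (HsForm.locHs_comp hσ hF he fun k => stdVec (j k)) hΩ
  refine LocHs.congr ((LocHs.sum hΩ Finset.univ fun i _ => LocHs.sum hΩ Finset.univ fun j _ =>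
    h1 i j).const_mul hΩ (1 / (p.factorial : ℝ))) fun S _ y hy => ?_
  exact (formNormSq_chart g _ he hy).symm

lemma inner_grad_grad {hσ' : 3 < σ - 1} (g : SmoothMetric M) (h : HsFamily hσ D a) :
    HsFamily hσ' D fun S x => g.inner x (grad g (a S) x) (grad g (a S) x) := by
  intro e he
  have hΩ := e.open_target
  refine LocHs.congr (LocHs.sum hΩ Finset.univ fun i _ => LocHs.sum hΩ Finset.univ fun j _ =>
    ((LocHs.smooth hΩ (contDiffOn_chartGram_inv g he i j)).mul
      ((h e he).fderiv_apply hΩ (stdVec j)) hΩ).mul ((h e he).fderiv_apply hΩ (stdVec i)) hΩ)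
      fun S hS y hy => ?_
  exact (inner_grad_grad_chart g he hy ((h.contMDiff 1 (by norm_num; linarith) hS).mdifferentiable
    (by norm_num) _)).symm

lemma locHs_chartCoord {hσ' : 3 < σ - 1} (g : SmoothMetric M) (h : HsFamily hσ D a)
    (h' : HsFamily hσ D a') {e : OpenPartialHomeomorph M E6}
    (he : e ∈ IsManifold.maximalAtlas (𝓡 6) ∞ M) (i : Fin 6) :
    LocHs e.target hσ' D (fun S => chartCoord e (fun x => a S x • grad g (a' S) x) i) := by
  have hΩ := e.open_target
  refine LocHs.congr (((h e he).mono (by linarith)).mul (LocHs.sum hΩ Finset.univ fun j _ =>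
    (LocHs.smooth hΩ (contDiffOn_chartGram_inv g he i j)).mul
      ((h' e he).fderiv_apply hΩ (stdVec j)) hΩ) hΩ) fun S hS y hy => ?_
  rw [← chartCoord_grad g he hy ((h'.contMDiff 1 (by norm_num; linarith) hS).mdifferentiable
    (by norm_num) _)]
  exact (congrArg (fun w : E6 => w i) (map_smul (chartCov e y) _ _)).symm

/-- One order is lost in the gradient and one in the divergence; the coefficients, made of `g^{ij}`
and `∂_k g_{ij}`, are smooth. -/
lemma diverg_smul_grad {τ : ℝ} {hτ : 3 < τ} (hτσ : τ + 2 ≤ σ) (g : SmoothMetric M)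
    (h : HsFamily hσ D a) (h' : HsFamily hσ D a') :
    HsFamily hτ D fun S x => diverg g (fun z => a S z • grad g (a' S) z) x := by
  intro e he
  have hΩ := e.open_target
  have hσ' : 3 < σ - 1 := by linarith
  have hσ'' : 3 < σ - 1 - 1 := by linarith
  have hX : ∀ e ∈ IsManifold.maximalAtlas (𝓡 6) ∞ M, ∀ i, LocHs e.target hσ' D
    (fun S => chartCoord e (fun x => a S x • grad g (a' S) x) i) :=
    fun e he => h.locHs_chartCoord g h' he
  have hdG : ∀ i j k, ContDiffOn ℝ ∞ (fun y => fderiv ℝ (fun z => chartGram g e z i j) y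
      (stdVec k)) e.target := fun i j k =>
    ((contDiffOn_chartGram g he i j).fderiv_of_isOpen hΩ (by simp)).clm_apply contDiffOn_const
  refine LocHs.congr ((LocHs.sum hΩ Finset.univ fun i _ =>
    ((hX e he i).fderiv_apply (hσ' := hσ'') hΩ (stdVec i)).mono (by linarith)).add
    (LocHs.sum hΩ Finset.univ fun k _ => (((LocHs.sum hΩ Finset.univ fun i _ =>
      LocHs.sum hΩ Finset.univ fun j _ => LocHs.smooth hΩ
        ((contDiffOn_chartGram_inv g he i j).mul (hdG i j k))).const_mul hΩ (1 / 2)).mul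
        ((hX e he k).mono (by linarith)) hΩ))) fun S hS y hy => ?_
  exact (diverg_chart g (fun e he y hy i => (((hX e he i).contDiffOn e.open_target 1
    (by norm_num; linarith) hS).contDiffAt (e.open_target.mem_nhds hy)).differentiableAt
    (by norm_num)) he hy).symm

lemma lap {τ : ℝ} {hτ : 3 < τ} (hτσ : τ + 2 ≤ σ) (g : SmoothMetric M) (h : HsFamily hσ D a) :
    HsFamily hτ D fun S => lap g (a S) := by
  have h1 := diverg_smul_grad (hτ := hτ) hτσ g
    (scalar (M := M) (hσ := hσ) (D := D) (c := fun _ => 1) continuousOn_const) h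
  simp only [one_smul] at h1
  exact h1

end HsFamily

/-! ### Positivity is an open condition -/

/-- Near `x` the function is its localization by a cut-off equal to 1 around `e x`, and that
localization varies continuously in the sup norm. -/
lemma HsFunction.continuous_eval [IsManifold (𝓡 6) ∞ M] (hσ : 3 < σ) :
    Continuous fun p : HsFunction M σ × M => p.1 p.2 := by
  rw [continuous_iff_continuousAt]
  rintro ⟨f, x⟩
  have he := IsManifold.chart_mem_maximalAtlas (I := 𝓡 6) (n := ∞) x
  set e := chartAt E6 x
  have hx : x ∈ e.source := mem_chart_source E6 x
  obtain ⟨K, hK, hxK, hKe⟩ := exists_compact_subset e.open_target (e.map_source hx)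
  obtain ⟨χ, h1, h2, h3, h4, -⟩ := exists_smooth_cutoff hK e.open_target hKe
  let l : Localizer M := ⟨e, he, χ, h1, h2, h3⟩
  have hc : ContinuousAt (fun p : HsFunction M σ × M => (synth hσ (p.1.locLp l) (e p.2)).re) (f, x) := by
    refine Complex.continuous_re.continuousAt.comp ?_
    have h5 : ContinuousAt (fun p : HsFunction M σ × M => (synth hσ (p.1.locLp l), e p.2)) (f, x) :=
      (((synth hσ).continuous.comp ((HsFunction.continuous_locLp l).comp
        continuous_fst)).continuousAt).prodMk
        ((e.continuousAt hx).comp (f := Prod.snd) continuousAt_snd)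
    exact (ContinuousEval.continuous_eval (F := BoundedContinuousFunction E6 ℂ)).continuousAt.comp h5
  refine hc.congr ?_
  have h6 : ∀ᶠ z in 𝓝 x, z ∈ e.source ∧ e z ∈ interior K :=
    Filter.Eventually.and (e.open_source.mem_nhds hx)
      ((e.continuousAt hx).eventually (isOpen_interior.mem_nhds hxK))
  filter_upwards [continuousAt_snd.eventually h6] with p hp
  rw [HsFunction.synth_locLp, Complex.ofReal_re]
  change χ (e p.2) * p.1 (e.symm (e p.2)) = p.1 p.2
  rw [h4 _ (interior_subset hp.2), one_mul, e.left_inv hp.1]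

/-- Joint continuity gives positivity near each pair `(f, x)`; compactness makes the neighbourhood
of `f` uniform in `x`. -/
lemma HsFunction.eventually_pos [IsManifold (𝓡 6) ∞ M] [CompactSpace M] (hσ : 3 < σ)
    {f : HsFunction M σ} (hf : ∀ x, 0 < f x) : ∀ᶠ f' in 𝓝 f, ∀ x, 0 < f' x := by
  have h := isCompact_univ.eventually_forall_of_forall_eventually (x₀ := f)
    (P := fun (f' : HsFunction M σ) (x : M) => 0 < f' x) fun x _ =>
    (HsFunction.continuous_eval hσ).continuousAt.eventually (lt_mem_nhds (hf x))
  simpa using h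

end Manifold

/-! ### The equations solved for the data -/

section Manifold

variable {M : Type*} [TopologicalSpace M] [ChartedSpace E6 M] [IsManifold (𝓡 6) ∞ M]

/-- The value of `2R - |F₁|²` forced by the second equation. -/
def scalarData (g : SmoothMetric M) (α β : ℝ) (F : DiffForm M 5) (v u : M → ℝ) (x : M) : ℝ :=
  (5 * lap g (fun z => u z ^ 2 * v z) x + 5 * (u x ^ 2 * lap g v x)
    - 6 * (v x * g.inner x (grad g u x) (grad g u x))
    - u x ^ 2 * (v x)⁻¹ ^ 3 * formNormSq g F x
    - 6 * (α * (u x * v x ^ 2) + β * v x ^ 2)) * (u x ^ 2 * v x)⁻¹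

/-- The value of `|F₃|² - 2T` forced by the first equation. -/
def stringData (g : SmoothMetric M) (α β : ℝ) (F : DiffForm M 5) (v u : M → ℝ) (x : M) : ℝ :=
  (α * (2 * v x ^ 3) - 10 * (u x * v x * lap g v x)
    - 6 * diverg g (fun z => v z ^ 2 • grad g u z) x
    - u x * (v x)⁻¹ ^ 2 * formNormSq g F x
    + u x * v x ^ 2 * scalarData g α β F v u x) * (u x)⁻¹

lemma formNormSq_zero (g : SmoothMetric M) (p : ℕ) (x : M) :
    formNormSq g (0 : DiffForm M p) x = 0 := by
  refine mul_eq_zero_of_right _ (Finset.sum_eq_zero fun i _ => Finset.sum_eq_zero fun j _ => ?_)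
  exact mul_eq_zero_of_right _ rfl

/-- For `q = 3` the powers of `v` at `F₃` and at `T` in the first equation are both `v⁰`, so these
terms combine to `u(|F₃|² - 2T)`. In the second equation both have coefficient zero. In both
equations `R` and `F₁` combine to a multiple of `2R - |F₁|²`. Each equation is thus the defining
formula of the corresponding datum with its denominator cleared. -/
lemma solvesEqMotion_of_data (g : SmoothMetric M) {α β : ℝ} {F : (p : ℕ) → DiffForm M p}
    {R T v u : M → ℝ} (hv : ContMDiff (𝓡 6) 𝓘(ℝ, ℝ) 2 v) (hu : ContMDiff (𝓡 6) 𝓘(ℝ, ℝ) 2 u)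
    (hv0 : ∀ x, 0 < v x) (hu0 : ∀ x, 0 < u x)
    (h0 : F 0 = 0) (h2 : F 2 = 0) (h4 : F 4 = 0) (h6 : F 6 = 0)
    (ha : ∀ x, 2 * R x - formNormSq g (F 1) x = scalarData g α β (F 5) v u x)
    (hb : ∀ x, formNormSq g (F 3) x - 2 * T x = stringData g α β (F 5) v u x) :
    SolvesEqMotion g 6 3 α β R F T v u where
  contMDiff_v := hv
  contMDiff_u := hu
  v_pos := hv0
  u_pos := hu0
  eq_u x := by
    have hv := (hv0 x).ne'
    have hu := (hu0 x).ne'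
    have hb' := hb x
    rw [stringData, ← ha x, eq_mul_inv_iff_mul_eq₀ hu] at hb'
    simp only [Finset.sum_range_succ, Finset.sum_range_zero, h0, h2, h4, h6, formNormSq_zero]
    norm_num
    rw [← inv_pow]
    linear_combination hb'
  eq_v x := by
    have hv := (hv0 x).ne'
    have hu := (hu0 x).ne'
    have ha' := ha x
    rw [scalarData, eq_mul_inv_iff_mul_eq₀ (by positivity)] at ha'
    simp only [Finset.sum_range_succ, Finset.sum_range_zero, h0, h2, h4, h6, formNormSq_zero]
    norm_num
    rw [← inv_pow]
    linear_combination -ha'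

variable {X : Type*} [TopologicalSpace X] {s : ℝ} {D : Set X} {α β : X → ℝ} {F : X → HsForm M 5 s}
  {v u : X → HsFunction M s}

/-- Second derivatives land in `H^{s-2}`, still an algebra because `s - 2 > 3`; the lower-order
factors are brought down to that space before being multiplied. -/
lemma hsFamily_scalarData (hs : 5 < s) {hσ : 3 < s - 2} (g : SmoothMetric M)
    (hα : ContinuousOn α D) (hβ : ContinuousOn β D) (hF : ContinuousOn F D)
    (hv : ContinuousOn v D) (hu : ContinuousOn u D) (hv0 : ∀ S ∈ D, ∀ x, 0 < v S x)
    (hu0 : ∀ S ∈ D, ∀ x, 0 < u S x) :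
    HsFamily hσ D fun S => scalarData g (α S) (β S) (F S).toForm (v S) (u S) := by
  have hs3 : 3 < s := by linarith
  have hs1 : 3 < s - 1 := by linarith
  have V := HsFamily.of_continuousOn hs3 hv
  have U := HsFamily.of_continuousOn hs3 hu
  have V' : HsFamily hσ D fun S => v S := V.mono (by linarith)
  have U' : HsFamily hσ D fun S => u S := U.mono (by linarith)
  have L : HsFamily hσ D fun S => lap g (v S) := V.lap (by linarith) g
  have L' : HsFamily hσ D fun S => lap g (fun z => u S z ^ 2 * v S z) :=
    ((U.pow 2).mul V).lap (by linarith) g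
  have N : HsFamily hσ D fun S x => g.inner x (grad g (u S) x) (grad g (u S) x) :=
    (U.inner_grad_grad (hσ' := hs1) g).mono (by linarith)
  have Q : HsFamily hσ D fun S x => formNormSq g (F S).toForm x :=
    (HsFamily.formNormSq (hσ := hs3) g hF).mono (by linarith)
  exact (((((L'.const_mul 5).add (((U'.pow 2).mul L).const_mul 5)).sub
    ((V'.mul N).const_mul 6)).sub (((U'.pow 2).mul ((V'.inv hv0).pow 3)).mul Q)).sub
    ((((HsFamily.scalar hα).mul (U'.mul (V'.pow 2))).add
      ((HsFamily.scalar hβ).mul (V'.pow 2))).const_mul 6)).mul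
    (((U'.pow 2).mul V').inv fun S hS x => mul_pos (pow_pos (hu0 S hS x) 2) (hv0 S hS x))

lemma hsFamily_stringData (hs : 5 < s) {hσ : 3 < s - 2} (g : SmoothMetric M)
    (hα : ContinuousOn α D) (hβ : ContinuousOn β D) (hF : ContinuousOn F D)
    (hv : ContinuousOn v D) (hu : ContinuousOn u D) (hv0 : ∀ S ∈ D, ∀ x, 0 < v S x)
    (hu0 : ∀ S ∈ D, ∀ x, 0 < u S x) :
    HsFamily hσ D fun S => stringData g (α S) (β S) (F S).toForm (v S) (u S) := by
  have hs3 : 3 < s := by linarith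
  have V := HsFamily.of_continuousOn hs3 hv
  have U := HsFamily.of_continuousOn hs3 hu
  have V' : HsFamily hσ D fun S => v S := V.mono (by linarith)
  have U' : HsFamily hσ D fun S => u S := U.mono (by linarith)
  have L : HsFamily hσ D fun S => lap g (v S) := V.lap (by linarith) g
  have E : HsFamily hσ D fun S => diverg g (fun z => v S z ^ 2 • grad g (u S) z) :=
    (V.pow 2).diverg_smul_grad (by linarith) g U
  have Q : HsFamily hσ D fun S x => formNormSq g (F S).toForm x :=
    (HsFamily.formNormSq (hσ := hs3) g hF).mono (by linarith)
  have A : HsFamily hσ D fun S => scalarData g (α S) (β S) (F S).toForm (v S) (u S) :=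
    hsFamily_scalarData hs g hα hβ hF hv hu hv0 hu0
  exact ((((((HsFamily.scalar hα).mul ((V'.pow 3).const_mul 2)).sub
    (((U'.mul V').mul L).const_mul 10)).sub (E.const_mul 6)).sub
    ((U'.mul ((V'.inv hv0).pow 2)).mul Q)).add ((U'.mul (V'.pow 2)).mul A)).mul (U'.inv hu0)

end Manifold

end

/-! ### The neighbourhood of positive pairs and the data maps -/

theorem mainTheorem7 (M : Type*) [TopologicalSpace M] [ChartedSpace E6 M]
    [IsManifold (𝓡 6) ∞ M] [T2Space M] [CompactSpace M]
    (g : SmoothMetric M) (s : ℝ) (hs : 5 < s) :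
    ∃ N ∈ 𝓝 ((1, 1) : HsFunction M s × HsFunction M s),
    ∃ a b : ℝ × ℝ × HsForm M 5 s × HsFunction M s × HsFunction M s → HsFunction M (s - 2),
      ContinuousOn a {S | (S.2.2.2.1, S.2.2.2.2) ∈ N} ∧
      ContinuousOn b {S | (S.2.2.2.1, S.2.2.2.2) ∈ N} ∧
      ∀ (α β : ℝ) (F₅ : HsForm M 5 s) (v u : HsFunction M s), (v, u) ∈ N →
        ∀ (R T : M → ℝ) (F : (p : ℕ) → DiffForm M p),
          F 0 = 0 → F 2 = 0 → F 4 = 0 → F 6 = 0 → F 5 = F₅.toForm →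
          (∀ x, 2 * R x - formNormSq g (F 1) x = a (α, β, F₅, v, u) x) →
          (∀ x, formNormSq g (F 3) x - 2 * T x = b (α, β, F₅, v, u) x) →
          SolvesEqMotion g 6 3 α β R F T v u := by
  have hs3 : 3 < s := by linarith
  have hσ : 3 < s - 2 := by linarith
  -- No smallness is required: positivity is all that the divisions by `v` and `u` need.
  set N : Set (HsFunction M s × HsFunction M s) := {p | (∀ x, 0 < p.1 x) ∧ ∀ x, 0 < p.2 x} with hN
  have hN1 : N ∈ 𝓝 ((1, 1) : HsFunction M s × HsFunction M s) :=
    (continuousAt_fst.eventually (HsFunction.eventually_pos hs3 fun _ => one_pos)).and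
      (continuousAt_snd.eventually (HsFunction.eventually_pos hs3 fun _ => one_pos))
  set D : Set (ℝ × ℝ × HsForm M 5 s × HsFunction M s × HsFunction M s) :=
    {S | (S.2.2.2.1, S.2.2.2.2) ∈ N} with hD
  have hα : ContinuousOn (fun S => S.1) D := continuous_fst.continuousOn
  have hβ : ContinuousOn (fun S => S.2.1) D := by fun_prop
  have hF : ContinuousOn (fun S => S.2.2.1) D := by fun_prop
  have hv : ContinuousOn (fun S => S.2.2.2.1) D := by fun_prop
  have hu : ContinuousOn (fun S => S.2.2.2.2) D := by fun_prop
  have hv0 : ∀ S ∈ D, ∀ x, 0 < S.2.2.2.1 x := fun S hS => hS.1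
  have hu0 : ∀ S ∈ D, ∀ x, 0 < S.2.2.2.2 x := fun S hS => hS.2
  obtain ⟨a, hac, ha⟩ := (hsFamily_scalarData hs (hσ := hσ) g hα hβ hF hv hu hv0
    hu0).exists_hsFunction
  obtain ⟨b, hbc, hb⟩ := (hsFamily_stringData hs (hσ := hσ) g hα hβ hF hv hu hv0
    hu0).exists_hsFunction
  refine ⟨N, hN1, a, b, hac, hbc, fun α β F₅ v u hvu R T F h0 h2 h4 h6 h5 hRa hTb => ?_⟩
  have hS : (α, β, F₅, v, u) ∈ D := hvu
  exact solvesEqMotion_of_data g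
    -- The Sobolev embedding into `C²` requires `3 + 2 < s`, which is the hypothesis on `s`.
    ((HsFamily.of_continuousOn hs3 hv).contMDiff 2 (by norm_num; linarith) hS)
    ((HsFamily.of_continuousOn hs3 hu).contMDiff 2 (by norm_num; linarith) hS) hvu.1 hvu.2
    h0 h2 h4 h6 (fun x => by rw [hRa, ha _ hS, h5]) fun x => by rw [hTb, hb _ hS, h5]
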